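/- For $n\ge 1$ and $f:\{0,1\}^n\to\{0,1\}$ let $|f\rangle=2^{-n/2}\sum_{x\in\{0,1\}^n}|x,f(x)\rangle$ be the function state and $g=(-1)^f$. Call $f$ monotone if $f(x)\le f(y)$ whenever $x_i\le y_i$ for all $i$, and $\varepsilon$-far from monotone if $\Pr_{x}[f(x)\ne h(x)]\ge\varepsilon$ for every monotone $h:\{0,1\}^n\to\{0,1\}$ ($x$ uniform). Write $\hat g(S)=\mathbb E_x\big[g(x)\prod_{i\in S}(-1)^{x_i}\big]$ for the Fourier coefficients, $D_ig(x)=\tfrac12\big(g(x^{i\to0})-g(x^{i\to1})\big)$ (where $x^{i\to b}$ is $x$ with the $i$-th bit replaced by $b$), $\mathbf I[g]=\sum_{i=1}^n\mathbb E_x[(D_ig(x))^2]$ for the total influence, and $$p(f)=\Pr_{x,i}\big[(x_i=0\wedge f(x)=1\wedge f(x+e_i)=0)\vee(x_i=1\wedge f(x)=0\wedge f(x+e_i)=1)\big]$$ ($x\in\{0,1\}^n$ and $i\in\{1,\dots,n\}$ uniform) for the pair-violation probability. Given $\varepsilon,\delta\in(0,1)$, put $m_2=\big\lceil \frac{n^2\ln(6/\delta)}{2(\varepsilon/3)^2}\big\rceil$,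 $m_1=\max\{3m_2,\lceil 18\ln(6/\delta)\rceil\}$, $m_5=\big\lceil\frac{4\ln(6n/\delta)}{(\varepsilon/3n)^2}\big\rceil$, and consider the following algorithm. 1. Use $m_1$ copies of $|f\rangle$, one at a time: apply a Hadamard gate to each of the $n+1$ qubits and measure the last qubit; if the outcome is $1$, measure the first $n$ qubits and record the result as a set $S\subseteq\{1,\dots,n\}$. Let $\hat{\mathbf I}$ be $1/m_2$ times the sum of $|S|$ over the first $m_2$ recorded sets (over all recorded sets, if there are fewer than $m_2$). 2. Measure $m_5$ further copies of $|f\rangle$ in the computational basis to obtain classical samples $(x_k,f(x_k))$, and put $\tilde g_i=\frac1{m_5}\sum_{k=1}^{m_5}(-1)^{(x_k)_i+f(x_k)}$ for $1\le i\le n$. 3. Put $\hat p=\frac1{2n}\hat{\mathbf I}-\frac1{2n}\sum_{i=1}^n\tilde g_i$. If $\hat p\le\varepsilon/3n$, accept; if $\hat p\ge 2\varepsilon/3n$ (and $\hat p>\varepsilon/3n$), reject; otherwise output nothing. **Theorem.** (a) For all $n\ge1$ and $f:\{0,1\}^n\to\{0,1\}$, $$p(f)=\frac{1}{2n}\Big(\mathbf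 I[g]-\sum_{i=1}^n\hat g(\{i\})\Big).$$ (b) There is an absolute constant $C>0$ such that for all $n\ge1$, $f:\{0,1\}^n\to\{0,1\}$ and $\varepsilon,\delta\in(0,1)$ the following hold. * The algorithm always uses exactly $m=m_1+m_5$ copies of $|f\rangle$, and $m\le C\,\dfrac{n^2\,(1+\ln n+\ln(1/\delta))}{\varepsilon^2}$. In particular $m=\tilde{\mathcal O}\big(n^2\log(1/\delta)/\varepsilon^2\big)$, where the tilde hides a factor logarithmic in $n$: if $\delta\le\frac12$ then $m\le C\,\dfrac{n^2(1+\ln n)\ln(1/\delta)}{\varepsilon^2}$. * The algorithm is efficient: carried out by one fixed program, independent of $n,\varepsilon,\delta$ and $f$, on a random access machine with a register of $n+1$ qubits, it always halts after at most $C\,\dfrac{n^3\,(1+\ln n+\ln(1/\delta))}{\varepsilon^2}$ elementary operations. Elementary operations are Hadamard, $T$ and controlled-NOT gates, measurements of single qubits in the computational basis, and classical operations on real numbers (arithmetic, comparison, logarithm, rounding up, memory access, loop control); loading a copy of $|f\rangle$ into the register costs $n+2$ operations. * With probability at least $1-\delta$ all of the following hold: if $f$ is monotone, the algorithm accepts;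 if $f$ is $\varepsilon$-far from monotone, the algorithm rejects; $|\hat{\mathbf I}-\mathbf I[g]|\le\varepsilon/3$; $|\tilde g_i-\hat g(\{i\})|\le\varepsilon/3n$ for all $i$; and $|\hat p-p(f)|\le\varepsilon/3n$. -/

import Mathlib

open scoped NNReal

namespace QTest

/-! ## Boolean functions, distance to monotonicity, Fourier analysis

Bits are `Bool` with `false < true`, so `Monotone f` for `f : (Fin n → Bool) → Bool` is
monotonicity for the coordinatewise order on the hypercube. -/

/-- `Pr_x [f x ≠ g x]` for uniformly random `x`. -/
noncomputable def relDist {n : ℕ} (f g : (Fin n → Bool) → Bool) : ℝ :=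
  ((Finset.univ.filter fun x => f x ≠ g x).card : ℝ) / 2 ^ n

/-- `f` is `ε`-far from all monotone functions. -/
def FarFromMonotone {n : ℕ} (ε : ℝ) (f : (Fin n → Bool) → Bool) : Prop :=
  ∀ g : (Fin n → Bool) → Bool, Monotone g → ε ≤ relDist f g

/-- The string `x + e_i`. -/
def flipBit {n : ℕ} (x : Fin n → Bool) (i : Fin n) : Fin n → Bool :=
  Function.update x i (!x i)

/-- The pair `x, x + e_i` violates monotonicity of `f`. -/
def Violates {n : ℕ} (f : (Fin n → Bool) → Bool) (x : Fin n → Bool) (i : Fin n) : Prop :=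
  (x i = false ∧ f x = true ∧ f (flipBit x i) = false) ∨
    (x i = true ∧ f x = false ∧ f (flipBit x i) = true)

open Classical in
/-- The probability that `x, x + e_i` violates monotonicity, for uniformly random `x` and `i`. -/
noncomputable def violationProb {n : ℕ} (f : (Fin n → Bool) → Bool) : ℝ :=
  ((Finset.univ.filter fun p : (Fin n → Bool) × Fin n => Violates f p.1 p.2).card : ℝ) /
    (2 ^ n * n)

/-- `g = (-1)^f`. -/
def signFn {n : ℕ} (f : (Fin n → Bool) → Bool) (x : Fin n → Bool) : ℝ :=
  if f x then -1 else 1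

/-- Expectation over a uniformly random point of the hypercube. -/
noncomputable def cubeExp {n : ℕ} (h : (Fin n → Bool) → ℝ) : ℝ :=
  (∑ x, h x) / 2 ^ n

/-- The Fourier coefficient `E_x [g(x) χ_S(x)]`, where `χ_S(x) = ∏_{i ∈ S} (-1)^{x_i}`. -/
noncomputable def cubeFourier {n : ℕ} (g : (Fin n → Bool) → ℝ) (S : Finset (Fin n)) : ℝ :=
  cubeExp fun x => g x * ∏ i ∈ S, (if x i then (-1 : ℝ) else 1)

/-- The `i`-th derivative; the bit `false` is the sign `+1` and the bit `true` is the sign `-1`. -/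
noncomputable def cubeDeriv {n : ℕ} (i : Fin n) (g : (Fin n → Bool) → ℝ) (x : Fin n → Bool) : ℝ :=
  (g (Function.update x i false) - g (Function.update x i true)) / 2

/-- The influence `Inf_i[g] = E_x [(D_i g(x))^2]`. -/
noncomputable def influence {n : ℕ} (i : Fin n) (g : (Fin n → Bool) → ℝ) : ℝ :=
  cubeExp fun x => cubeDeriv i g x ^ 2

/-- The total influence `I[g]`. -/
noncomputable def totalInfluence {n : ℕ} (g : (Fin n → Bool) → ℝ) : ℝ :=
  ∑ i, influence i g

/-! ## A register of `n + 1` qubits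

A (pure) state is a nonzero amplitude vector, considered up to normalisation. Qubits are numbered
`0, …, n`. Gates and measurements addressing a nonexistent qubit do nothing. -/

/-- Amplitude vectors of `n + 1` qubits. -/
abbrev Amp (n : ℕ) : Type := (Fin (n + 1) → Bool) → ℂ

/-- The function state `2^{-n/2} ∑_x |x, f(x)⟩`; qubits `0, …, n-1` hold `x`, qubit `n` holds
`f(x)`. -/
noncomputable def functionState {n : ℕ} (f : (Fin n → Bool) → Bool) : Amp n :=
  fun z => if z (Fin.last n) = f (fun i => z i.castSucc) then ((1 / √(2 ^ n) : ℝ) : ℂ) else 0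

/-- The Hadamard gate on qubit `q`. -/
noncomputable def gateH {n : ℕ} (q : ℕ) (ψ : Amp n) : Amp n :=
  if h : q < n + 1 then
    fun z => (ψ (Function.update z ⟨q, h⟩ false) +
      (if z ⟨q, h⟩ then -1 else 1) * ψ (Function.update z ⟨q, h⟩ true)) / ((√2 : ℝ) : ℂ)
  else ψ

/-- The `T` gate (`diag(1, e^{iπ/4})`) on qubit `q`. -/
noncomputable def gateT {n : ℕ} (q : ℕ) (ψ : Amp n) : Amp n :=
  if h : q < n + 1 then
    fun z => (if z ⟨q, h⟩ then Complex.exp (Complex.I * (Real.pi / 4 : ℝ)) else 1) * ψ z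
  else ψ

/-- The controlled-NOT gate with control `q` and target `t ≠ q`. -/
noncomputable def gateCNOT {n : ℕ} (q t : ℕ) (ψ : Amp n) : Amp n :=
  if h : q < n + 1 ∧ t < n + 1 ∧ q ≠ t then
    fun z => ψ (Function.update z ⟨t, h.2.1⟩ (xor (z ⟨t, h.2.1⟩) (z ⟨q, h.1⟩)))
  else ψ

/-- The projection of `ψ` to the subspace on which qubit `q` has the value `b`. -/
noncomputable def project {n : ℕ} (q : Fin (n + 1)) (b : Bool) (ψ : Amp n) : Amp n :=
  fun z => if z q = b then ψ z else 0

/-- The squared norm of an amplitude vector. -/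
noncomputable def sqNorm {n : ℕ} (ψ : Amp n) : ℝ≥0 := ∑ z, ‖ψ z‖₊ ^ 2

/-- Born's rule: the probability of the outcome `true` when qubit `q` is measured. -/
noncomputable def bornProb {n : ℕ} (q : Fin (n + 1)) (ψ : Amp n) : ℝ≥0 :=
  sqNorm (project q true ψ) / sqNorm ψ

theorem bornProb_le_one {n : ℕ} (q : Fin (n + 1)) (ψ : Amp n) : bornProb q ψ ≤ 1 := by
  refine div_le_one_of_le₀ ?_ zero_le
  refine Finset.sum_le_sum fun z _ => ?_
  unfold project
  split_ifs <;> simp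

/-- The distribution of the outcome when qubit `q` is measured in the computational basis. -/
noncomputable def bornPMF {n : ℕ} (q : Fin (n + 1)) (ψ : Amp n) : PMF Bool :=
  PMF.ofFintype (fun b => ((if b then bornProb q ψ else 1 - bornProb q ψ : ℝ≥0) : ENNReal)) (by
    rw [Fintype.sum_bool, ← ENNReal.coe_add]
    simp [bornProb_le_one q ψ])

/-! ## A random access machine with a quantum register

Classical memory: named scalar variables and one array, holding real numbers. Quantum memory:
`n + 1` qubits. The machine can load a fresh copy of the function state (discarding the previous
contents of the quantum register), apply the gates `H`, `T`, `CNOT` to single qubits (pairs of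
qubits), measure single qubits, and do elementary classical operations. Programs are finite and do
not depend on `n`. Loops are bounded, so every program halts. -/

/-- Names of scalar variables. -/
inductive Var
  | n | eps | delta
  | eps2 | eps5 | delta1 | delta2 | delta5 | m1 | m2 | m5
  | ell | i | bit | label | weight | found | total
  | Ihat | gsum | phat
  deriving DecidableEq

/-- Classical expressions. -/
inductive CExpr
  | const (k : ℕ)
  | var (v : Var)
  | arr (idx : CExpr)
  | add (a b : CExpr)
  | sub (a b : CExpr)
  | mul (a b : CExpr)
  | div (a b : CExpr)
  | log (a : CExpr)
  | ceil (a : CExpr)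

instance : Coe Var CExpr := ⟨CExpr.var⟩
instance (k : ℕ) : OfNat CExpr k := ⟨CExpr.const k⟩
instance : Add CExpr := ⟨CExpr.add⟩
instance : Sub CExpr := ⟨CExpr.sub⟩
instance : Mul CExpr := ⟨CExpr.mul⟩
instance : Div CExpr := ⟨CExpr.div⟩

/-- The number of elementary operations needed to evaluate an expression: one for every constant,
memory access, arithmetic operation, logarithm and rounding. -/
def CExpr.cost : CExpr → ℕ
  | const _ => 1
  | var _ => 1
  | arr a => a.cost + 1
  | add a b => a.cost + b.cost + 1
  | sub a b => a.cost + b.cost + 1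
  | mul a b => a.cost + b.cost + 1
  | div a b => a.cost + b.cost + 1
  | log a => a.cost + 1
  | ceil a => a.cost + 1

/-- The value of an expression. -/
noncomputable def CExpr.eval (reg : Var → ℝ) (mem : ℕ → ℝ) : CExpr → ℝ
  | const k => k
  | var v => reg v
  | arr a => mem ⌊a.eval reg mem⌋₊
  | add a b => a.eval reg mem + b.eval reg mem
  | sub a b => a.eval reg mem - b.eval reg mem
  | mul a b => a.eval reg mem * b.eval reg mem
  | div a b => a.eval reg mem / b.eval reg mem
  | log a => Real.log (a.eval reg mem)
  | ceil a => (⌈a.eval reg mem⌉ : ℝ)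

/-- Programs. -/
inductive Prog
  /-- do nothing -/
  | skip
  /-- `v := e` -/
  | assign (v : Var) (e : CExpr)
  /-- `mem[idx] := e` -/
  | store (idx e : CExpr)
  /-- run one program after the other -/
  | seq (p q : Prog)
  /-- if `a ≤ b` then `p` else `q` -/
  | ifLE (a b : CExpr) (p q : Prog)
  /-- for `v = 0, 1, …, e - 1` run `p` -/
  | loop (v : Var) (e : CExpr) (p : Prog)
  /-- load a fresh copy of the function state into the quantum register -/
  | fresh
  /-- apply a Hadamard gate -/
  | had (q : CExpr)
  /-- apply a `T` gate -/
  | tgate (q : CExpr)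
  /-- apply a controlled-NOT gate -/
  | cnot (q t : CExpr)
  /-- measure a qubit and write the outcome (`0` or `1`) to `v` -/
  | meas (q : CExpr) (v : Var)
  /-- output `true` (accept) or `false` (reject) -/
  | answer (b : Bool)

infixr:50 ";; " => Prog.seq

/-- A configuration of the machine, together with counters for the elementary operations performed
and the copies of the function state used so far. -/
structure Config (n : ℕ) where
  reg : Var → ℝ
  mem : ℕ → ℝ
  psi : Amp n
  out : Option Bool
  steps : ℕ
  copies : ℕ

namespace Config

variable {n : ℕ}

/-- Add `k` elementary operations to the counter. -/
def tick (c : Config n) (k : ℕ) : Config n := { c with steps := c.steps + k }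

/-- Overwrite a scalar variable. -/
def set (c : Config n) (v : Var) (r : ℝ) : Config n := { c with reg := Function.update c.reg v r }

/-- The value of an expression. -/
noncomputable def val (c : Config n) (e : CExpr) : ℝ := e.eval c.reg c.mem

/-- The value of an expression that is used as an index or as a loop bound. -/
noncomputable def idx (c : Config n) (e : CExpr) : ℕ := ⌊c.val e⌋₊

/-- Measure qubit `q` and write the outcome to `v`. -/
noncomputable def measure (c : Config n) (q : ℕ) (v : Var) : PMF (Config n) :=
  if h : q < n + 1 then
    (bornPMF ⟨q, h⟩ c.psi).map fun b =>
      { c.set v (if b then 1 else 0) with psi := project ⟨q, h⟩ b c.psi }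
  else PMF.pure c

end Config

/-- Run `body 0`, `body 1`, …, `body (k - 1)` one after the other. -/
noncomputable def iterateM {α : Type} (body : ℕ → α → PMF α) : ℕ → α → PMF α
  | 0, c => PMF.pure c
  | k + 1, c => (iterateM body k c).bind (body k)

/-- The distribution of the final configuration when a program is run with access to copies of the
function state of `f`. Every instruction costs one elementary operation plus the cost of evaluating
its expressions; every pass through a loop costs one more operation, and loading a copy of the
function state costs one operation for each of its `n + 1` qubits. -/
noncomputable def Prog.exec {n : ℕ} (f : (Fin n → Bool) → Bool) :
    Prog → Config n → PMF (Config n)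
  | skip, c => PMF.pure (c.tick 1)
  | assign v e, c => PMF.pure ((c.set v (c.val e)).tick (1 + e.cost))
  | store a e, c =>
      PMF.pure { c.tick (1 + a.cost + e.cost) with
        mem := Function.update c.mem (c.idx a) (c.val e) }
  | seq p q, c => (exec f p c).bind fun c' => exec f q c'
  | ifLE a b p q, c =>
      open Classical in
      if c.val a ≤ c.val b then exec f p (c.tick (1 + a.cost + b.cost))
      else exec f q (c.tick (1 + a.cost + b.cost))
  | loop v e p, c =>
      iterateM (fun k c' => exec f p ((c'.set v k).tick 1)) (c.idx e) (c.tick (1 + e.cost))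
  | fresh, c =>
      PMF.pure { c.tick (1 + (n + 1)) with psi := functionState f, copies := c.copies + 1 }
  | had q, c => PMF.pure { c.tick (1 + q.cost) with psi := gateH (c.idx q) c.psi }
  | tgate q, c => PMF.pure { c.tick (1 + q.cost) with psi := gateT (c.idx q) c.psi }
  | cnot q t, c =>
      PMF.pure { c.tick (1 + q.cost + t.cost) with psi := gateCNOT (c.idx q) (c.idx t) c.psi }
  | meas q v, c => (c.tick (1 + q.cost)).measure (c.idx q) v
  | answer b, c => PMF.pure { c.tick 1 with out := some b }

/-! ## The monotonicity tester -/

open Prog CExpr in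
/-- Parameters: `ε₂ = ε/3`, `ε₅ = ε/(3n)`, `δ₁ = δ₂ = δ/3`, `δ₅ = δ/(3n)` and the sample sizes. -/
def initialization : Prog :=
  assign .eps2 (Var.eps / 3);;
  assign .eps5 (Var.eps / (3 * Var.n));;
  assign .delta1 (Var.delta / 3);;
  assign .delta2 (Var.delta / 3);;
  assign .delta5 (Var.delta / (3 * Var.n));;
  assign .m2 (ceil (Var.n * Var.n * log (2 / Var.delta2) / (2 * (Var.eps2 * Var.eps2))));;
  assign .m1 (ceil (18 * log (2 / Var.delta1)));;
  ifLE Var.m1 (3 * Var.m2) (assign .m1 (3 * Var.m2)) skip;;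
  assign .m5 (ceil (4 * log (2 / Var.delta5) / (Var.eps5 * Var.eps5)))

open Prog CExpr in
/-- One attempt at Fourier sampling: apply `H` to all `n + 1` qubits of a copy and measure the last
qubit. If the outcome is `1`, the other `n` qubits are measured, which gives the indicator string of
a set `S`; if fewer than `m2` sets were found before, `|S|` is added to `total`. -/
def fourierAttempt : Prog :=
  fresh;;
  loop .i (Var.n + 1) (had Var.i);;
  meas Var.n .label;;
  ifLE 1 Var.label
    (assign .weight 0;;
      loop .i Var.n (meas Var.i .bit;; assign .weight (Var.weight + Var.bit));;
      ifLE (Var.found + 1) Var.m2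
        (assign .total (Var.total + Var.weight);; assign .found (Var.found + 1))
        skip)
    skip

open Prog CExpr in
/-- One classical sample `(x, f(x))`, obtained by measuring all qubits of a copy; the sign
`(-1)^{x_i + f(x)}` is added to `mem[i]` for every `i`. -/
def classicalSample : Prog :=
  fresh;;
  meas Var.n .label;;
  loop .i Var.n
    (meas Var.i .bit;;
      store Var.i (arr Var.i + (1 - 2 * Var.bit) * (1 - 2 * Var.label)))

open Prog CExpr in
/-- The tester. The estimate of the total influence is left in `Ihat`, the estimate of the `i`-th
degree-one Fourier coefficient in `mem[i]`, and the estimate of the violation probability in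
`phat`. -/
def tester : Prog :=
  initialization;;
  assign .found 0;;
  assign .total 0;;
  loop .ell Var.m1 fourierAttempt;;
  assign .Ihat (Var.total / Var.m2);;
  loop .i Var.n (store Var.i 0);;
  loop .ell Var.m5 classicalSample;;
  loop .i Var.n (store Var.i (arr Var.i / Var.m5));;
  assign .gsum 0;;
  loop .i Var.n (assign .gsum (Var.gsum + arr Var.i));;
  assign .phat (Var.Ihat / (2 * Var.n) - Var.gsum / (2 * Var.n));;
  ifLE Var.phat (Var.eps / (3 * Var.n))
    (answer true)
    (ifLE (2 * Var.eps / (3 * Var.n)) Var.phat (answer false) skip)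

/-- The initial configuration: the inputs `n`, `ε`, `δ`, all other variables `0`, and the qubits in
the state `|0…0⟩`. -/
noncomputable def initConfig (n : ℕ) (ε δ : ℝ) : Config n where
  reg := fun v => match v with
    | .n => n
    | .eps => ε
    | .delta => δ
    | _ => 0
  mem := fun _ => 0
  psi := Pi.single (fun _ => false) 1
  out := none
  steps := 0
  copies := 0

/-- The distribution of the final configuration of the tester. -/
noncomputable def runTester {n : ℕ} (f : (Fin n → Bool) → Bool) (ε δ : ℝ) : PMF (Config n) :=
  tester.exec f (initConfig n ε δ)

/-- The number of copies of the function state that the tester uses,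
`max {3 m₂, ⌈18 ln(2/δ₁)⌉} + m₅`. -/
noncomputable def copyCount (n : ℕ) (ε δ : ℝ) : ℕ :=
  max (3 * ⌈(n : ℝ) ^ 2 * Real.log (2 / (δ / 3)) / (2 * (ε / 3) ^ 2)⌉₊)
      ⌈18 * Real.log (2 / (δ / 3))⌉₊ +
    ⌈4 * Real.log (2 / (δ / (3 * n))) / (ε / (3 * n)) ^ 2⌉₊

end QTest

open QTest

namespace QTest

/-! ## Fourier analysis on the cube -/

/-! On an edge in direction i the derivative D_i g takes values in {-1, 0, 1}, and the edge violates
monotonicity exactly when the value is -1, so the indicator of a violation is (D² - D)/2. The mean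
of D² is the influence and the mean of D is ĝ({i}); this is part (a), see `two_mul_violations`.

Two facts about p(f) separate the cases: it vanishes for monotone f, and it is at least ε/n when f
is ε-far. For the second, sort f along one direction after another. Sorting creates no violations in
other directions (`violations_sortDir_le`), so the result is monotone, and the number of changed
points is at most the number of violating pairs (x, i). Hence an estimate of p(f) up to ε/3n
suffices.

For the estimate, Hadamard gates turn the function state into one with amplitude ĝ(S)/√2 at |S,1⟩
(`hadState_functionState`). Half of the attempts succeed, and then S has the law ĝ(S)², under which
|S| has mean I[g] (`sum_card_mul_cubeFourier_sq`). Classical samples give ĝ({i}) as an ordinary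
mean.

The program is analysed by pulling expectations `wp` back through its instructions. Sequences of
measurements are treated with unnormalised vectors (`sqNorm_mul_wp_bornPMF`), which avoids
conditional probabilities. The exact law of one loop pass then shows that an exponential potential
grows in expectation by at most a fixed factor per pass (`wp_iterateM_le`), and Markov's inequality
gives the tails. No independence has to be formulated, and the random number of recorded sets does
no harm because the potential is compensated by the current count. Running time and copies are
bounded separately, by the rules for `Prog.Costs`. -/

theorem flipBit_flipBit {n : ℕ} (x : Fin n → Bool) (i : Fin n) :
    flipBit (flipBit x i) i = x := by
  simp [flipBit]

/-- Flipping a bit, as a permutation of the cube. -/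
def flipEquiv {n : ℕ} (i : Fin n) : (Fin n → Bool) ≃ (Fin n → Bool) where
  toFun x := flipBit x i
  invFun x := flipBit x i
  left_inv x := flipBit_flipBit x i
  right_inv x := flipBit_flipBit x i

theorem sum_flipBit {n : ℕ} {M : Type*} [AddCommMonoid M] (i : Fin n) (h : (Fin n → Bool) → M) :
    ∑ x, h (flipBit x i) = ∑ x, h x :=
  (flipEquiv i).sum_comp h

/-- The sign `(-1)^b`. -/
def bsign (b : Bool) : ℝ := if b then -1 else 1

@[simp] theorem bsign_true : bsign true = -1 := rfl
@[simp] theorem bsign_false : bsign false = 1 := rfl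

theorem bsign_mul_self (b : Bool) : bsign b * bsign b = 1 := by cases b <;> simp

theorem bsign_not (b : Bool) : bsign (!b) = -bsign b := by cases b <;> simp

theorem signFn_eq {n : ℕ} (f : (Fin n → Bool) → Bool) (x : Fin n → Bool) :
    signFn f x = bsign (f x) := rfl

theorem cubeFourier_eq {n : ℕ} (g : (Fin n → Bool) → ℝ) (S : Finset (Fin n)) :
    cubeFourier g S = (∑ x, g x * ∏ i ∈ S, bsign (x i)) / 2 ^ n := rfl

/-- Orthogonality of characters: the sum over S factorises into ∏ (1 + (-1)^{x_i + y_i}), and a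
coordinate where x and y differ contributes the factor 0. -/
theorem sum_powerset_prod_bsign {n : ℕ} (x y : Fin n → Bool) :
    ∑ S : Finset (Fin n), (∏ i ∈ S, bsign (x i)) * ∏ i ∈ S, bsign (y i) =
      if x = y then 2 ^ n else 0 := by
  have h : ∑ S : Finset (Fin n), (∏ i ∈ S, bsign (x i)) * ∏ i ∈ S, bsign (y i) =
      ∏ i, (1 + bsign (x i) * bsign (y i)) := by
    rw [Finset.prod_one_add, Finset.powerset_univ]
    exact Finset.sum_congr rfl fun S _ => Finset.prod_mul_distrib.symm
  rw [h]
  split_ifs with hxy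
  · subst hxy
    simp [bsign_mul_self]
    norm_num
  · obtain ⟨i, hi⟩ := Function.ne_iff.mp hxy
    refine Finset.prod_eq_zero (Finset.mem_univ i) ?_
    revert hi
    cases x i <;> cases y i <;> simp

theorem parseval {n : ℕ} (g : (Fin n → Bool) → ℝ) :
    ∑ S, cubeFourier g S ^ 2 = cubeExp fun x => g x ^ 2 := by
  have h : ∀ S : Finset (Fin n), cubeFourier g S ^ 2 =
      (∑ x, ∑ y, g x * g y * ((∏ i ∈ S, bsign (x i)) * ∏ i ∈ S, bsign (y i))) / (2 ^ n) ^ 2 := by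
    intro S
    rw [cubeFourier_eq, div_pow, sq (∑ x, _), Finset.sum_mul_sum]
    congr 1
    exact Finset.sum_congr rfl fun x _ => Finset.sum_congr rfl fun y _ => by ring
  simp_rw [h]
  rw [← Finset.sum_div, Finset.sum_comm]
  simp_rw [Finset.sum_comm (s := (Finset.univ : Finset (Finset (Fin n)))), ← Finset.mul_sum,
    sum_powerset_prod_bsign]
  simp only [mul_ite, mul_zero, Finset.sum_ite_eq, Finset.mem_univ, if_true]
  rw [← Finset.sum_mul, cubeExp]
  field_simp

/-- The derivative and half the difference along the edge agree up to sign, which the square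
removes. The right-hand side is preferable because flipping a bit acts diagonally on Fourier
coefficients. -/
theorem cubeDeriv_sq {n : ℕ} (i : Fin n) (g : (Fin n → Bool) → ℝ) (x : Fin n → Bool) :
    cubeDeriv i g x ^ 2 = ((g x - g (flipBit x i)) / 2) ^ 2 := by
  unfold cubeDeriv flipBit
  cases h : x i
  · rw [← h, Function.update_eq_self, h]; simp
  · rw [← h, Function.update_eq_self, h]; simp; ring

theorem prod_bsign_flipBit {n : ℕ} (S : Finset (Fin n)) (x : Fin n → Bool) (i : Fin n) :
    ∏ j ∈ S, bsign (flipBit x i j) =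
      (if i ∈ S then -1 else 1) * ∏ j ∈ S, bsign (x j) := by
  split_ifs with h
  · rw [← Finset.mul_prod_erase S _ h, ← Finset.mul_prod_erase S (fun j => bsign (x j)) h]
    rw [Finset.prod_congr rfl (g := fun j => bsign (x j))]
    · simp [flipBit, bsign_not]
    · intro j hj
      simp [flipBit, Function.update_of_ne (Finset.ne_of_mem_erase hj)]
  · rw [one_mul]
    refine Finset.prod_congr rfl fun j hj => ?_
    rw [flipBit, Function.update_of_ne]
    rintro rfl
    exact h hj

/-- Parseval for (g - g ∘ flip)/2: flipping bit i multiplies the coefficient at S by -1 if i ∈ S and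
by 1 otherwise, so exactly the coefficients with i ∈ S survive. -/
theorem influence_eq {n : ℕ} (i : Fin n) (g : (Fin n → Bool) → ℝ) :
    influence i g = ∑ S, if i ∈ S then cubeFourier g S ^ 2 else 0 := by
  unfold influence
  simp_rw [cubeDeriv_sq]
  rw [← parseval fun x => (g x - g (flipBit x i)) / 2]
  refine Finset.sum_congr rfl fun S _ => ?_
  have h : cubeFourier (fun x => (g x - g (flipBit x i)) / 2) S =
      (cubeFourier g S - (if i ∈ S then -1 else 1) * cubeFourier g S) / 2 := by
    have h2 : ∑ x, g (flipBit x i) * ∏ j ∈ S, bsign (x j) =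
        (if i ∈ S then -1 else 1) * ∑ x, g x * ∏ j ∈ S, bsign (x j) := by
      rw [← sum_flipBit i, Finset.mul_sum]
      refine Finset.sum_congr rfl fun x _ => ?_
      rw [flipBit_flipBit, prod_bsign_flipBit]
      ring
    simp only [cubeFourier_eq]
    rw [mul_div_assoc', ← h2, ← sub_div, ← Finset.sum_sub_distrib, div_right_comm, Finset.sum_div _ _ (2 : ℝ)]
    congr 1
    exact Finset.sum_congr rfl fun x _ => by ring
  rw [h]
  split_ifs <;> ring

/-- After exchanging the sums, S is counted once for each of its elements. This identifies the mean
of |S| under Fourier sampling. -/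
theorem sum_card_mul_cubeFourier_sq {n : ℕ} (g : (Fin n → Bool) → ℝ) :
    ∑ S, cubeFourier g S ^ 2 * (S.card : ℝ) = totalInfluence g := by
  unfold totalInfluence
  simp_rw [influence_eq]
  rw [Finset.sum_comm]
  refine Finset.sum_congr rfl fun S _ => ?_
  rw [← Finset.sum_filter, Finset.sum_const]
  simp [mul_comm]

theorem sum_cubeFourier_sq_signFn {n : ℕ} (f : (Fin n → Bool) → Bool) :
    ∑ S, cubeFourier (signFn f) S ^ 2 = 1 := by
  rw [parseval, cubeExp]
  simp [signFn_eq, sq, bsign_mul_self]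

/-! ## The violation probability -/

/-- The condition depends only on the edge and not on which endpoint x is, so `violations` counts
each violating edge twice. -/
theorem violates_iff {n : ℕ} (f : (Fin n → Bool) → Bool) (x : Fin n → Bool) (i : Fin n) :
    Violates f x i ↔
      f (Function.update x i false) = true ∧ f (Function.update x i true) = false := by
  unfold Violates flipBit
  cases h : x i
  · have : Function.update x i false = x := by rw [← h, Function.update_eq_self]
    simp [this]
  · have : Function.update x i true = x := by rw [← h, Function.update_eq_self]
    simp [this, and_comm]

open Classical in
/-- The number of points `x` for which `x, x + e_i` violates monotonicity. -/
noncomputable def violations {n : ℕ} (f : (Fin n → Bool) → Bool) (i : Fin n) : ℕ :=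
  (Finset.univ.filter fun x => Violates f x i).card

theorem violationProb_eq {n : ℕ} (f : (Fin n → Bool) → Bool) :
    violationProb f = (∑ i, (violations f i : ℝ)) / (2 ^ n * n) := by
  classical
  unfold violationProb violations
  congr 1
  rw [← Nat.cast_sum]
  congr 1
  simp only [Finset.card_filter]
  rw [Fintype.sum_prod_type, Finset.sum_comm]

/-- The contributions of x and its flip add up to twice the derivative, and the flip permutes the
cube. -/
theorem sum_mul_bsign {n : ℕ} (g : (Fin n → Bool) → ℝ) (i : Fin n) :
    ∑ x, g x * bsign (x i) = ∑ x, cubeDeriv i g x := by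
  have h1 := sum_flipBit i fun x => g x * bsign (x i)
  have h2 : ∑ x, (g x * bsign (x i) + g (flipBit x i) * bsign (flipBit x i i)) =
      ∑ x, 2 * cubeDeriv i g x := by
    refine Finset.sum_congr rfl fun x _ => ?_
    unfold cubeDeriv flipBit
    cases h : x i
    · rw [← h, Function.update_eq_self, h]; simp; ring
    · rw [← h, Function.update_eq_self, h]; simp; ring
  rw [Finset.sum_add_distrib, h1, ← Finset.mul_sum] at h2
  linarith

/-- Pointwise, D² - D equals 2 where D = -1 and vanishes where D is 0 or 1; D = -1 is the violating
case. -/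
theorem two_mul_violations {n : ℕ} (f : (Fin n → Bool) → Bool) (i : Fin n) :
    2 * (violations f i : ℝ) =
      2 ^ n * (influence i (signFn f) - cubeFourier (signFn f) {i}) := by
  classical
  rw [influence, cubeFourier_eq, cubeExp]
  simp only [Finset.prod_singleton]
  rw [sum_mul_bsign, ← sub_div, ← Finset.sum_sub_distrib, mul_div_cancel₀ _ (by positivity),
    violations, Finset.card_filter, Nat.cast_sum, Finset.mul_sum]
  refine Finset.sum_congr rfl fun x _ => ?_
  rw [if_congr (violates_iff f x i) rfl rfl, cubeDeriv, signFn_eq, signFn_eq]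
  cases f (Function.update x i false) <;> cases f (Function.update x i true) <;> norm_num

theorem violationProb_eq_fourier {n : ℕ} (f : (Fin n → Bool) → Bool) :
    violationProb f =
      (totalInfluence (signFn f) - ∑ i, cubeFourier (signFn f) {i}) / (2 * n) := by
  have h : ∀ i, (violations f i : ℝ) =
      2 ^ n * (influence i (signFn f) - cubeFourier (signFn f) {i}) / 2 := fun i => by
    rw [← two_mul_violations]; ring
  rw [violationProb_eq]
  simp_rw [h]
  rw [← Finset.sum_div, ← Finset.mul_sum, Finset.sum_sub_distrib, totalInfluence]
  field_simp

/-! ## Distance to monotonicity -/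

theorem violationProb_of_monotone {n : ℕ} {f : (Fin n → Bool) → Bool} (hf : Monotone f) :
    violationProb f = 0 := by
  classical
  have h : ∀ i, violations f i = 0 := by
    intro i
    rw [violations, Finset.card_eq_zero, Finset.filter_eq_empty_iff]
    intro x _ hx
    rw [violates_iff] at hx
    have := hf (show Function.update x i false ≤ Function.update x i true from
      update_le_update_iff.mpr ⟨Bool.false_le true, fun _ _ => le_rfl⟩)
    rw [hx.1, hx.2] at this
    exact absurd this (by decide)
  simp [violationProb_eq, h]

/-- Monotonicity along edges suffices: for x ≤ y the bits of x are replaced by those of y one at a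
time, and each replacement either changes nothing or moves up an edge. -/
theorem monotone_of_violations_eq_zero {n : ℕ} {f : (Fin n → Bool) → Bool}
    (hf : ∀ i, violations f i = 0) : Monotone f := by
  classical
  have key : ∀ i x, f (Function.update x i false) ≤ f (Function.update x i true) := by
    intro i x
    have := hf i
    rw [violations, Finset.card_eq_zero, Finset.filter_eq_empty_iff] at this
    have := this (Finset.mem_univ x)
    rw [violates_iff] at this
    revert this
    cases f (Function.update x i false) <;> cases f (Function.update x i true) <;> simp
  intro x y hxy
  have step : ∀ s : Finset (Fin n), f x ≤ f fun i => if i ∈ s then y i else x i := by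
    intro s
    induction s using Finset.induction_on with
    | empty => simp
    | insert i s hi ih =>
      refine ih.trans ?_
      set u : Fin n → Bool := fun j => if j ∈ s then y j else x j with hu
      have e1 : u = Function.update u i (x i) := by
        rw [eq_comm, Function.update_eq_iff]; simp [hu, hi]
      have e2 : (fun j => if j ∈ insert i s then y j else x j) = Function.update u i (y i) := by
        funext j
        by_cases hj : j = i
        · subst hj; simp
        · simp [hj, hu]
      rw [e2]
      conv_lhs => rw [e1]
      have := hxy i
      have hk := key i u
      revert this
      cases x i <;> cases y i <;> simp [hk]
  simpa using step Finset.univ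

/-- Sort the two values on every edge in direction `i`. -/
def sortDir {n : ℕ} (i : Fin n) (f : (Fin n → Bool) → Bool) (x : Fin n → Bool) : Bool :=
  if x i then f (Function.update x i false) || f (Function.update x i true)
  else f (Function.update x i false) && f (Function.update x i true)

/-- The number of points at which two functions differ. -/
def diffCount {n : ℕ} (f g : (Fin n → Bool) → Bool) : ℕ :=
  (Finset.univ.filter fun x => f x ≠ g x).card

theorem diffCount_triangle {n : ℕ} (f g h : (Fin n → Bool) → Bool) :
    diffCount f h ≤ diffCount f g + diffCount g h := by
  unfold diffCount
  refine le_trans (Finset.card_le_card ?_) (Finset.card_union_le _ _)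
  intro x
  simp only [Finset.mem_filter, Finset.mem_univ, true_and, Finset.mem_union]
  intro hx
  by_contra! hc
  exact hx (hc.1.trans hc.2)

/-- Sorting changes f at both endpoints of a violating edge and nowhere else, and `violations`
counts both endpoints. -/
theorem diffCount_sortDir {n : ℕ} (i : Fin n) (f : (Fin n → Bool) → Bool) :
    diffCount f (sortDir i f) = violations f i := by
  classical
  unfold diffCount violations
  congr 1
  ext x
  simp only [Finset.mem_filter, Finset.mem_univ, true_and, violates_iff]
  cases h : x i
  · have hx : Function.update x i false = x := by rw [← h, Function.update_eq_self]
    have hs : sortDir i f x = (f x && f (Function.update x i true)) := by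
      rw [sortDir, h, hx]; rfl
    rw [hs, hx]
    cases f x <;> cases f (Function.update x i true) <;> simp
  · have hx : Function.update x i true = x := by rw [← h, Function.update_eq_self]
    have hs : sortDir i f x = (f (Function.update x i false) || f x) := by
      rw [sortDir, h, hx]; rfl
    rw [hs, hx]
    cases f x <;> cases f (Function.update x i false) <;> simp

theorem violations_sortDir_self {n : ℕ} (i : Fin n) (f : (Fin n → Bool) → Bool) :
    violations (sortDir i f) i = 0 := by
  classical
  rw [violations, Finset.card_eq_zero, Finset.filter_eq_empty_iff]
  intro x _
  rw [violates_iff]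
  simp only [sortDir, Function.update_self, Function.update_idem]
  cases f (Function.update x i false) <;> cases f (Function.update x i true) <;> simp

theorem two_mul_sum_eq {n : ℕ} (i : Fin n) (h : (Fin n → Bool) → ℕ) :
    2 * ∑ x, h x = ∑ x, (h (Function.update x i false) + h (Function.update x i true)) := by
  rw [two_mul]
  nth_rewrite 2 [← sum_flipBit i]
  rw [← Finset.sum_add_distrib]
  refine Finset.sum_congr rfl fun x _ => ?_
  unfold flipBit
  cases hx : x i
  · rw [← hx, Function.update_eq_self, hx]; simp
  · rw [← hx, Function.update_eq_self, hx]; simp [add_comm]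

/-- The claim localises to two-dimensional faces: on a square, sorting in direction i does not
increase the number of violating edges in direction j. This is a check of the 16 Boolean functions
on the square. -/
theorem violations_sortDir_le {n : ℕ} (i j : Fin n) (f : (Fin n → Bool) → Bool) :
    violations (sortDir i f) j ≤ violations f j := by
  classical
  by_cases hij : j = i
  · subst hij; simp [violations_sortDir_self]
  unfold violations
  rw [Finset.card_filter, Finset.card_filter]
  refine Nat.le_of_mul_le_mul_left ?_ two_pos
  -- Summing over both values of bit i brings the four corners of a face into one summand.
  rw [two_mul_sum_eq i, two_mul_sum_eq i]
  refine Finset.sum_le_sum fun x _ => ?_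
  simp only [violates_iff, sortDir]
  simp only [Function.update_comm (Ne.symm hij), Function.update_self, Function.update_idem]
  generalize f (Function.update (Function.update x j false) i false) = a
  generalize f (Function.update (Function.update x j false) i true) = b
  generalize f (Function.update (Function.update x j true) i false) = c
  generalize f (Function.update (Function.update x j true) i true) = d
  revert a b c d
  decide

/-- Sort the directions successively. Directions already sorted stay free of violations, and each
sorting costs at most the violations that f had originally in that direction. -/
theorem exists_monotone_diffCount_le {n : ℕ} (f : (Fin n → Bool) → Bool) :
    ∃ h : (Fin n → Bool) → Bool, Monotone h ∧ diffCount f h ≤ ∑ i, violations f i := by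
  have key : ∀ s : Finset (Fin n), ∃ h : (Fin n → Bool) → Bool,
      (∀ i ∈ s, violations h i = 0) ∧ (∀ i, violations h i ≤ violations f i) ∧
      diffCount f h ≤ ∑ i ∈ s, violations f i := by
    intro s
    induction s using Finset.induction_on with
    | empty => exact ⟨f, by simp, fun _ => le_rfl, by simp [diffCount]⟩
    | insert i s hi ih =>
      obtain ⟨h, h1, h2, h3⟩ := ih
      refine ⟨sortDir i h, fun j hj => ?_, fun j => (violations_sortDir_le i j h).trans (h2 j), ?_⟩
      · rcases Finset.mem_insert.mp hj with rfl | hj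
        · exact violations_sortDir_self _ _
        · exact Nat.le_zero.mp ((violations_sortDir_le i j h).trans (h1 j hj).le)
      · rw [Finset.sum_insert hi, add_comm]
        refine (diffCount_triangle f h _).trans (add_le_add h3 ?_)
        rw [diffCount_sortDir]
        exact h2 i
  obtain ⟨h, h1, -, h3⟩ := key Finset.univ
  exact ⟨h, monotone_of_violations_eq_zero fun i => h1 i (Finset.mem_univ i), h3⟩

theorem FarFromMonotone.le_violationProb {n : ℕ} (hn : 1 ≤ n) {ε : ℝ}
    {f : (Fin n → Bool) → Bool} (hf : FarFromMonotone ε f) : ε / n ≤ violationProb f := by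
  obtain ⟨h, hm, hd⟩ := exists_monotone_diffCount_le f
  have hn' : (0 : ℝ) < n := by exact_mod_cast hn
  have h1 : ε ≤ (diffCount f h : ℝ) / 2 ^ n := hf h hm
  have h2 : (diffCount f h : ℝ) ≤ ∑ i, (violations f i : ℝ) := by exact_mod_cast hd
  rw [violationProb_eq, ← div_div]
  gcongr
  exact h1.trans (by gcongr)

/-! ## Hoeffding's lemma for finite distributions -/

/-- The weights define a `PMF`, for which a variable with values in [a, b] is sub-Gaussian with
parameter ((b - a)/2)²; half of it times t² is the exponent. -/
theorem sum_mul_exp_le {ι : Type*} [Fintype ι] {w X : ι → ℝ} {a b : ℝ} (hw : ∀ i, 0 ≤ w i)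
    (hsum : ∑ i, w i = 1) (hX : ∀ i, X i ∈ Set.Icc a b) (t : ℝ) :
    ∑ i, w i * Real.exp (t * (X i - ∑ j, w j * X j)) ≤ Real.exp (t ^ 2 * (b - a) ^ 2 / 8) := by
  let _ : MeasurableSpace ι := ⊤
  have : MeasurableSingletonClass ι := ⟨fun _ => trivial⟩
  have hs : ∑ i, ENNReal.ofReal (w i) = 1 := by
    rw [← ENNReal.ofReal_sum_of_nonneg fun i _ => hw i, hsum, ENNReal.ofReal_one]
  set p : PMF ι := PMF.ofFintype (fun i => ENNReal.ofReal (w i)) hs with hp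
  have hint : ∀ g : ι → ℝ, ∫ i, g i ∂p.toMeasure = ∑ i, w i * g i := by
    intro g
    rw [PMF.integral_eq_sum]
    refine Finset.sum_congr rfl fun i _ => ?_
    simp [hp, ENNReal.toReal_ofReal (hw i)]
  have h := (ProbabilityTheory.hasSubgaussianMGF_of_mem_Icc (μ := p.toMeasure) (X := X)
    (measurable_from_top.aemeasurable) (Filter.Eventually.of_forall hX)).mgf_le t
  rw [ProbabilityTheory.mgf, hint, hint] at h
  refine h.trans (le_of_eq ?_)
  congr 1
  simp only [NNReal.coe_pow, NNReal.coe_div, coe_nnnorm, NNReal.coe_ofNat, div_pow,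
    Real.norm_eq_abs, sq_abs]
  ring

/-! ## Sample sizes -/

/-- The number of sets that are used in the estimate of the total influence. -/
noncomputable def setCount (n : ℕ) (ε δ : ℝ) : ℕ :=
  ⌈(n : ℝ) ^ 2 * Real.log (2 / (δ / 3)) / (2 * (ε / 3) ^ 2)⌉₊

/-- The number of copies used for Fourier sampling. -/
noncomputable def fourierCount (n : ℕ) (ε δ : ℝ) : ℕ :=
  max (3 * setCount n ε δ) ⌈18 * Real.log (2 / (δ / 3))⌉₊

/-- The number of copies used for classical samples. -/
noncomputable def sampleCount (n : ℕ) (ε δ : ℝ) : ℕ :=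
  ⌈4 * Real.log (2 / (δ / (3 * n))) / (ε / (3 * n)) ^ 2⌉₊

theorem copyCount_eq (n : ℕ) (ε δ : ℝ) :
    copyCount n ε δ = fourierCount n ε δ + sampleCount n ε δ := rfl

/-- This absorbs the constant ln 6 of the sample sizes into twice the factor 1 + ln n + ln(1/δ). -/
theorem log_six_le_two : Real.log 6 ≤ 2 := by
  rw [Real.log_le_iff_le_exp (by norm_num)]
  have h : (2.7 : ℝ) ≤ Real.exp 1 := by linarith [Real.exp_one_gt_d9]
  rw [show (2 : ℝ) = 1 + 1 by norm_num, Real.exp_add]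
  nlinarith

theorem log_two_div_div_three {δ : ℝ} (hδ : 0 < δ) :
    Real.log (2 / (δ / 3)) = Real.log 6 + Real.log (1 / δ) := by
  rw [← Real.log_mul (by norm_num) (by positivity)]
  congr 1
  field_simp
  norm_num

theorem log_two_div_div_three_mul {n : ℕ} (hn : 1 ≤ n) {δ : ℝ} (hδ : 0 < δ) :
    Real.log (2 / (δ / (3 * n))) = Real.log 6 + Real.log n + Real.log (1 / δ) := by
  have hn' : (0 : ℝ) < n := by exact_mod_cast hn
  rw [← Real.log_mul (by norm_num) hn'.ne', ← Real.log_mul (by positivity) (by positivity)]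
  congr 1
  field_simp
  norm_num

theorem log_two_div_pos {δ : ℝ} (h0 : 0 < δ) (h1 : δ < 1) : 0 < Real.log (2 / (δ / 3)) := by
  apply Real.log_pos
  rw [lt_div_iff₀ (by positivity)]
  linarith

theorem log_two_div_mul_pos {n : ℕ} (hn : 1 ≤ n) {δ : ℝ} (h0 : 0 < δ) (h1 : δ < 1) :
    0 < Real.log (2 / (δ / (3 * n))) := by
  have hn' : (1 : ℝ) ≤ n := by exact_mod_cast hn
  apply Real.log_pos
  rw [lt_div_iff₀ (by positivity), one_mul, div_lt_iff₀ (by positivity)]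
  linarith

section Bounds

variable {n : ℕ} {ε δ : ℝ}

theorem one_le_log_factor (hδ : 0 < δ) (hδ1 : δ < 1) :
    1 ≤ 1 + Real.log n + Real.log (1 / δ) := by
  have h1 : 0 ≤ Real.log n := Real.log_natCast_nonneg n
  have h2 : 0 ≤ Real.log (1 / δ) := Real.log_nonneg (by rw [le_div_iff₀ hδ]; linarith)
  linarith

/-- Everything is measured in units of a = n²L/ε². Since a ≥ L ≥ 1, each rounding up costs at most
one further a, and 110 = 37 + 73. -/
theorem copyCount_le (hn : 1 ≤ n) (hε : 0 < ε) (hε1 : ε < 1) (hδ : 0 < δ) (hδ1 : δ < 1) :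
    (copyCount n ε δ : ℝ) ≤
      110 * (n ^ 2 * (1 + Real.log n + Real.log (1 / δ)) / ε ^ 2) := by
  have hn' : (1 : ℝ) ≤ n := by exact_mod_cast hn
  have h1 : 0 ≤ Real.log n := Real.log_natCast_nonneg n
  have h2 : 0 ≤ Real.log (1 / δ) := Real.log_nonneg (by rw [le_div_iff₀ hδ]; linarith)
  have h6 := log_six_le_two
  have hp2 := log_two_div_pos hδ hδ1
  have hp5 := log_two_div_mul_pos hn hδ hδ1
  set L := 1 + Real.log n + Real.log (1 / δ) with hL
  have hL1 : 1 ≤ L := by linarith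
  set a := n ^ 2 * L / ε ^ 2 with ha
  have hLa : L ≤ a := by
    rw [ha, le_div_iff₀ (by positivity)]
    have e1 : ε ^ 2 ≤ 1 := pow_le_one₀ hε.le hε1.le
    have e2 : (1 : ℝ) ≤ n ^ 2 := one_le_pow₀ hn'
    nlinarith
  have l1 : Real.log (2 / (δ / 3)) ≤ 2 * L := by rw [log_two_div_div_three hδ]; linarith
  have l5 : Real.log (2 / (δ / (3 * n))) ≤ 2 * L := by
    rw [log_two_div_div_three_mul hn hδ]; linarith
  have b2 : (setCount n ε δ : ℝ) ≤ 10 * a := by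
    have h := Nat.ceil_lt_add_one
      (show 0 ≤ (n : ℝ) ^ 2 * Real.log (2 / (δ / 3)) / (2 * (ε / 3) ^ 2) by positivity)
    have h' : (n : ℝ) ^ 2 * Real.log (2 / (δ / 3)) / (2 * (ε / 3) ^ 2) ≤ 9 * a := by
      calc _ ≤ (n : ℝ) ^ 2 * (2 * L) / (2 * (ε / 3) ^ 2) := by gcongr
        _ = 9 * a := by rw [ha]; field_simp; norm_num
    unfold setCount
    linarith
  have b1 : (⌈18 * Real.log (2 / (δ / 3))⌉₊ : ℝ) ≤ 37 * a := by
    have h := Nat.ceil_lt_add_one (show 0 ≤ 18 * Real.log (2 / (δ / 3)) by positivity)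
    linarith
  have b5 : (sampleCount n ε δ : ℝ) ≤ 73 * a := by
    have h := Nat.ceil_lt_add_one
      (show 0 ≤ 4 * Real.log (2 / (δ / (3 * n))) / (ε / (3 * n)) ^ 2 by positivity)
    have h' : 4 * Real.log (2 / (δ / (3 * n))) / (ε / (3 * n)) ^ 2 ≤ 72 * a := by
      calc _ ≤ 4 * (2 * L) / (ε / (3 * n)) ^ 2 := by gcongr
        _ = 72 * a := by rw [ha]; field_simp; norm_num
    unfold sampleCount
    linarith
  rw [copyCount_eq, fourierCount]
  push_cast
  have := max_le (show 3 * (setCount n ε δ : ℝ) ≤ 37 * a by linarith) b1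
  linarith

/-- Since 2 ln 2 > 1, two of the three copies of the product dominate 1 + ln n, and the third
dominates ln(1/δ). -/
theorem log_factor_le (hδ : 0 < δ) (hδ2 : δ ≤ 1 / 2) :
    1 + Real.log n + Real.log (1 / δ) ≤ 3 * ((1 + Real.log n) * Real.log (1 / δ)) := by
  have h1 : 0 ≤ Real.log n := Real.log_natCast_nonneg n
  have h2 : 0.69 ≤ Real.log (1 / δ) := by
    have : Real.log 2 ≤ Real.log (1 / δ) := by
      apply Real.log_le_log two_pos
      rw [le_div_iff₀ hδ]
      linarith
    linarith [Real.log_two_gt_d9]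
  nlinarith

end Bounds

/-! ## Expectations of `ℝ≥0∞`-valued functions under a `PMF` -/

/-- The expectation of `φ`. -/
noncomputable def wp {α : Type*} (μ : PMF α) (φ : α → ENNReal) : ENNReal := ∑' a, μ a * φ a

section wp

variable {α β : Type*}

@[simp] theorem wp_pure (a : α) (φ : α → ENNReal) : wp (PMF.pure a) φ = φ a := by
  rw [wp, tsum_eq_single a]
  · simp
  · intro b hb; simp [hb]

@[simp] theorem wp_bind (μ : PMF α) (k : α → PMF β) (φ : β → ENNReal) :
    wp (μ.bind k) φ = wp μ fun a => wp (k a) φ := by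
  simp only [wp, PMF.bind_apply, ← ENNReal.tsum_mul_right, ← ENNReal.tsum_mul_left]
  rw [ENNReal.tsum_comm]
  simp only [mul_assoc]

@[simp] theorem wp_map (μ : PMF α) (g : α → β) (φ : β → ENNReal) :
    wp (μ.map g) φ = wp μ fun a => φ (g a) := by
  rw [← PMF.bind_pure_comp, wp_bind]
  simp

theorem wp_mono {μ : PMF α} {φ ψ : α → ENNReal} (h : ∀ a ∈ μ.support, φ a ≤ ψ a) :
    wp μ φ ≤ wp μ ψ := by
  refine ENNReal.tsum_le_tsum fun a => ?_
  by_cases ha : μ a = 0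
  · simp [ha]
  · gcongr
    exact h a ((PMF.mem_support_iff _ _).mpr ha)

theorem wp_congr {μ : PMF α} {φ ψ : α → ENNReal} (h : ∀ a ∈ μ.support, φ a = ψ a) :
    wp μ φ = wp μ ψ :=
  le_antisymm (wp_mono fun a ha => (h a ha).le) (wp_mono fun a ha => (h a ha).ge)

theorem wp_const_mul (μ : PMF α) (r : ENNReal) (φ : α → ENNReal) :
    wp μ (fun a => r * φ a) = r * wp μ φ := by
  simp only [wp, ← ENNReal.tsum_mul_left]
  exact tsum_congr fun a => by ring

theorem wp_add (μ : PMF α) (φ ψ : α → ENNReal) :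
    wp μ (fun a => φ a + ψ a) = wp μ φ + wp μ ψ := by
  simp only [wp, ← ENNReal.tsum_add, mul_add]

theorem wp_sum {ι : Type*} (s : Finset ι) (μ : PMF α) (φ : ι → α → ENNReal) :
    wp μ (fun a => ∑ i ∈ s, φ i a) = ∑ i ∈ s, wp μ (φ i) := by
  classical
  induction s using Finset.induction_on with
  | empty => simp [wp]
  | insert i s hi ih => simp [Finset.sum_insert hi, wp_add, ih]

theorem wp_const (μ : PMF α) (r : ENNReal) : wp μ (fun _ => r) = r := by
  simp [wp, ENNReal.tsum_mul_right]

theorem wp_le_of_support {μ : PMF α} {φ : α → ENNReal} {r : ENNReal}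
    (h : ∀ a ∈ μ.support, φ a ≤ r) : wp μ φ ≤ r :=
  (wp_mono h).trans (wp_const μ r).le

theorem wp_eq_of_support {μ : PMF α} {φ : α → ENNReal} {r : ENNReal}
    (h : ∀ a ∈ μ.support, φ a = r) : wp μ φ = r :=
  (wp_congr h).trans (wp_const μ r)

open Classical in
theorem wp_indicator (μ : PMF α) (s : Set α) :
    wp μ (fun a => if a ∈ s then 1 else 0) = μ.toOuterMeasure s := by
  rw [wp, PMF.toOuterMeasure_apply]
  exact tsum_congr fun a => by by_cases h : a ∈ s <;> simp [h]

/-- This turns an exact expectation into a statement about all reachable outcomes. -/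
theorem wp_eq_zero_iff (μ : PMF α) (p : α → Prop) [DecidablePred p] :
    wp μ (fun a => if p a then 0 else 1) = 0 ↔ ∀ a ∈ μ.support, p a := by
  simp only [wp, ENNReal.tsum_eq_zero, mul_eq_zero, PMF.mem_support_iff]
  refine forall_congr' fun a => ?_
  by_cases h : p a <;> simp [h]

theorem wp_fintype [Fintype α] (μ : PMF α) (φ : α → ENNReal) :
    wp μ φ = ∑ a, μ a * φ a := tsum_fintype _

end wp

/-! ## Loops -/

section iterateM

variable {α : Type} {body : ℕ → α → PMF α}

theorem iterateM_support {P : ℕ → α → Prop} {K : ℕ}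
    (h : ∀ k < K, ∀ c, P k c → ∀ c' ∈ (body k c).support, P (k + 1) c') {c : α} (hc : P 0 c) :
    ∀ c' ∈ (iterateM body K c).support, P K c' := by
  induction K with
  | zero => intro c' hc'; simp [iterateM] at hc'; exact hc' ▸ hc
  | succ K ih =>
    intro c' hc'
    simp only [iterateM, PMF.mem_support_bind_iff] at hc'
    obtain ⟨c'', h1, h2⟩ := hc'
    exact h K K.lt_succ_self c'' (ih (fun k hk => h k (hk.trans K.lt_succ_self)) c'' h1) c' h2

/-- The supermartingale argument: if one pass multiplies the expected potential by at most r on the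
invariant, K passes multiply it by at most r^K. -/
theorem wp_iterateM_le {I : α → Prop} {Φ : α → ENNReal} {r : ENNReal}
    (hI : ∀ k c, I c → ∀ c' ∈ (body k c).support, I c')
    (h : ∀ k c, I c → wp (body k c) Φ ≤ r * Φ c) (K : ℕ) {c : α} (hc : I c) :
    wp (iterateM body K c) Φ ≤ r ^ K * Φ c := by
  induction K with
  | zero => simp [iterateM]
  | succ K ih =>
    rw [iterateM, wp_bind]
    have hs := iterateM_support (P := fun _ => I) (K := K) (fun k _ => hI k) hc
    calc wp (iterateM body K c) (fun c' => wp (body K c') Φ)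
        ≤ wp (iterateM body K c) (fun c' => r * Φ c') := wp_mono fun c' hc' => h K c' (hs c' hc')
      _ = r * wp (iterateM body K c) Φ := wp_const_mul _ _ _
      _ ≤ r * (r ^ K * Φ c) := by gcongr
      _ = r ^ (K + 1) * Φ c := by ring

end iterateM

/-! ## Variables that a program does not change -/

/-- `v` is not the target of an assignment, a measurement or a loop in the program. -/
def Prog.keeps (v : Var) : Prog → Bool
  | .assign w _ => w ≠ v
  | .seq p q => p.keeps v && q.keeps v
  | .ifLE _ _ p q => p.keeps v && q.keeps v
  | .loop w _ p => w ≠ v && p.keeps v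
  | .meas _ w => w ≠ v
  | _ => true

section exec

variable {n : ℕ} (f : (Fin n → Bool) → Bool)

theorem Config.measure_support {c : Config n} {q : ℕ} {v : Var} {c' : Config n}
    (h : c' ∈ (c.measure q v).support) :
    (∀ w, w ≠ v → c'.reg w = c.reg w) ∧ c'.steps = c.steps ∧ c'.copies = c.copies := by
  unfold Config.measure at h
  split_ifs at h
  · rw [PMF.mem_support_map_iff] at h
    obtain ⟨b, -, rfl⟩ := h
    refine ⟨fun w hw => ?_, rfl, rfl⟩
    simp [Config.set, hw]
  · rw [PMF.mem_support_pure_iff] at h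
    subst h
    exact ⟨fun _ _ => rfl, rfl, rfl⟩

theorem Prog.reg_eq_of_keeps {v : Var} {p : Prog} (hp : p.keeps v = true) {c c' : Config n}
    (h : c' ∈ (p.exec f c).support) : c'.reg v = c.reg v := by
  induction p generalizing c c' with
  | skip => simp only [exec, PMF.mem_support_pure_iff] at h; subst h; rfl
  | assign w e =>
    simp only [exec, PMF.mem_support_pure_iff] at h; subst h
    simp only [keeps, decide_eq_true_eq] at hp
    simp [Config.tick, Config.set, hp.symm]
  | store a e => simp only [exec, PMF.mem_support_pure_iff] at h; subst h; rfl
  | seq p q ihp ihq =>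
    simp only [exec, PMF.mem_support_bind_iff] at h
    simp only [keeps, Bool.and_eq_true] at hp
    obtain ⟨c'', h1, h2⟩ := h
    rw [ihq hp.2 h2, ihp hp.1 h1]
  | ifLE a b p q ihp ihq =>
    simp only [keeps, Bool.and_eq_true] at hp
    simp only [exec] at h
    split_ifs at h
    · exact (ihp hp.1 h).trans rfl
    · exact (ihq hp.2 h).trans rfl
  | loop w e p ih =>
    simp only [keeps, Bool.and_eq_true, decide_eq_true_eq] at hp
    simp only [exec] at h
    refine iterateM_support (P := fun _ c' => c'.reg v = c.reg v) ?_ (by rfl) c' h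
    intro k _ c1 h1 c2 h2
    rw [ih hp.2 h2, ← h1]
    simp [Config.tick, Config.set, hp.1.symm]
  | fresh => simp only [exec, PMF.mem_support_pure_iff] at h; subst h; rfl
  | had => simp only [exec, PMF.mem_support_pure_iff] at h; subst h; rfl
  | tgate => simp only [exec, PMF.mem_support_pure_iff] at h; subst h; rfl
  | cnot => simp only [exec, PMF.mem_support_pure_iff] at h; subst h; rfl
  | meas q w =>
    simp only [keeps, decide_eq_true_eq] at hp
    exact (Config.measure_support h).1 v hp.symm
  | answer => simp only [exec, PMF.mem_support_pure_iff] at h; subst h; rfl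

/-! ## Running time and number of copies -/

/-- From every configuration satisfying `I`, the program takes at most `T` elementary operations
and exactly `K` copies, and it preserves `I`. -/
def Prog.Costs (I : (Var → ℝ) → Prop) (p : Prog) (T K : ℕ) : Prop :=
  ∀ c : Config n, I c.reg → ∀ c' ∈ (p.exec f c).support,
    I c'.reg ∧ c'.steps ≤ c.steps + T ∧ c'.copies = c.copies + K

/-- `I` does not depend on the variable `v`. -/
def Ignores (I : (Var → ℝ) → Prop) (v : Var) : Prop :=
  ∀ r x, I r → I (Function.update r v x)

variable {f} {I : (Var → ℝ) → Prop}

namespace Prog.Costs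

theorem skip : Costs f I .skip 1 0 := by
  intro c hc c' h
  simp only [exec, PMF.mem_support_pure_iff] at h; subst h
  exact ⟨hc, le_rfl, rfl⟩

theorem answer (b : Bool) : Costs f I (.answer b) 1 0 := by
  intro c hc c' h
  simp only [exec, PMF.mem_support_pure_iff] at h; subst h
  exact ⟨hc, le_rfl, rfl⟩

theorem assign {v : Var} (hv : Ignores I v) (e : CExpr) :
    Costs f I (.assign v e) (1 + e.cost) 0 := by
  intro c hc c' h
  simp only [exec, PMF.mem_support_pure_iff] at h; subst h
  exact ⟨hv _ _ hc, le_rfl, rfl⟩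

theorem store (a e : CExpr) : Costs f I (.store a e) (1 + a.cost + e.cost) 0 := by
  intro c hc c' h
  simp only [exec, PMF.mem_support_pure_iff] at h; subst h
  exact ⟨hc, le_rfl, rfl⟩

theorem fresh : Costs f I .fresh (n + 2) 1 := by
  intro c hc c' h
  simp only [exec, PMF.mem_support_pure_iff] at h; subst h
  refine ⟨hc, ?_, rfl⟩
  simp only [Config.tick]
  omega

theorem had (q : CExpr) : Costs f I (.had q) (1 + q.cost) 0 := by
  intro c hc c' h
  simp only [exec, PMF.mem_support_pure_iff] at h; subst h
  exact ⟨hc, le_rfl, rfl⟩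

theorem meas {v : Var} (hv : Ignores I v) (q : CExpr) :
    Costs f I (.meas q v) (1 + q.cost) 0 := by
  intro c hc c' h
  obtain ⟨h1, h2, h3⟩ := Config.measure_support h
  refine ⟨?_, h2.le, h3⟩
  have : c'.reg = Function.update c.reg v (c'.reg v) := by
    funext w
    by_cases hw : w = v
    · subst hw; simp
    · simp [hw, h1 w hw, Config.tick]
  rw [this]
  exact hv _ _ hc

theorem seq {p q : Prog} {T T' K K' : ℕ} (hp : Costs f I p T K) (hq : Costs f I q T' K') :
    Costs f I (.seq p q) (T + T') (K + K') := by
  intro c hc c' h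
  simp only [exec, PMF.mem_support_bind_iff] at h
  obtain ⟨c'', h1, h2⟩ := h
  obtain ⟨a1, a2, a3⟩ := hp c hc c'' h1
  obtain ⟨b1, b2, b3⟩ := hq c'' a1 c' h2
  exact ⟨b1, by omega, by omega⟩

/-- Adding both branches is a crude but sufficient time bound. The number of copies is exact, so
both branches must agree on K. -/
theorem ifLE (a b : CExpr) {p q : Prog} {T T' K : ℕ} (hp : Costs f I p T K)
    (hq : Costs f I q T' K) : Costs f I (.ifLE a b p q) (1 + a.cost + b.cost + (T + T')) K := by
  intro c hc c' h
  simp only [exec] at h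
  split_ifs at h
  · obtain ⟨a1, a2, a3⟩ := hp _ (by exact hc) c' h
    simp only [Config.tick] at a2 a3
    exact ⟨a1, by omega, by omega⟩
  · obtain ⟨a1, a2, a3⟩ := hq _ (by exact hc) c' h
    simp only [Config.tick] at a2 a3
    exact ⟨a1, by omega, by omega⟩

theorem loop {v : Var} (hv : Ignores I v) {e : CExpr} {m : ℕ}
    (he : ∀ r mem, I r → e.eval r mem = m) {p : Prog} {T K : ℕ} (hp : Costs f I p T K) :
    Costs f I (.loop v e p) (1 + e.cost + m * (T + 1)) (m * K) := by
  intro c hc c' h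
  simp only [exec] at h
  have hm : c.idx e = m := by rw [Config.idx, Config.val, he _ _ hc, Nat.floor_natCast]
  rw [hm] at h
  have := iterateM_support (P := fun k c' => I c'.reg ∧
    c'.steps ≤ c.steps + (1 + e.cost) + k * (T + 1) ∧ c'.copies = c.copies + k * K) ?_ ?_ c' h
  · exact ⟨this.1, by linarith [this.2.1], this.2.2⟩
  · rintro k - c1 ⟨h1, h2, h3⟩ c2 hc2
    obtain ⟨a1, a2, a3⟩ := hp _ (by exact hv _ _ h1) c2 hc2
    simp only [Config.tick, Config.set] at a2 a3
    exact ⟨a1, by rw [add_mul]; omega, by rw [add_mul]; omega⟩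
  · exact ⟨hc, by simp [Config.tick], by simp [Config.tick]⟩

end Prog.Costs

end exec

/-! ## Measurements -/

section measurement

variable {n : ℕ}

theorem sqNorm_project_add (q : Fin (n + 1)) (ψ : Amp n) :
    sqNorm (project q true ψ) + sqNorm (project q false ψ) = sqNorm ψ := by
  unfold sqNorm project
  rw [← Finset.sum_add_distrib]
  refine Finset.sum_congr rfl fun z _ => ?_
  cases z q <;> simp

/-- For ψ = 0 the quotient is a division by zero, but the projection vanishes as well, so no
assumption on ψ is needed. -/
theorem sqNorm_mul_bornProb (q : Fin (n + 1)) (ψ : Amp n) :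
    sqNorm ψ * bornProb q ψ = sqNorm (project q true ψ) := by
  unfold bornProb
  by_cases h : sqNorm ψ = 0
  · have := sqNorm_project_add q ψ
    rw [h, add_eq_zero] at this
    rw [h, zero_mul, this.1]
  · exact mul_div_cancel₀ _ h

/-- Born's rule without division. Weighted by squared norms, successive measurements compose: the
weight of a branch is the squared norm of its projected vector. -/
theorem sqNorm_mul_wp_bornPMF (q : Fin (n + 1)) (ψ : Amp n) (φ : Bool → ENNReal) :
    (sqNorm ψ : ENNReal) * wp (bornPMF q ψ) φ =
      ∑ b, (sqNorm (project q b ψ) : ENNReal) * φ b := by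
  have h0 : sqNorm ψ * (1 - bornProb q ψ) = sqNorm (project q false ψ) := by
    rw [mul_tsub, mul_one, sqNorm_mul_bornProb, ← sqNorm_project_add q ψ, add_tsub_cancel_left]
  rw [wp_fintype, Fintype.sum_bool, Fintype.sum_bool, mul_add, ← mul_assoc, ← mul_assoc,
    ← sqNorm_mul_bornProb, ← h0]
  simp [bornPMF]

namespace Config

/-- The configuration after the outcome `b` of a measurement of qubit `q`, written to `v`. -/
noncomputable def collapse (c : Config n) (q : ℕ) (v : Var) (b : Bool) : Config n :=
  if h : q < n + 1 then
    { c.set v (if b then 1 else 0) with psi := project ⟨q, h⟩ b c.psi }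
  else c

theorem sqNorm_mul_wp_measure (c : Config n) {q : ℕ} (hq : q < n + 1) (v : Var)
    (φ : Config n → ENNReal) :
    (sqNorm c.psi : ENNReal) * wp (c.measure q v) φ =
      ∑ b, (sqNorm (c.collapse q v b).psi : ENNReal) * φ (c.collapse q v b) := by
  rw [measure, dif_pos hq, wp_map, sqNorm_mul_wp_bornPMF]
  simp only [collapse, dif_pos hq]

/-- The configuration after the steps `step 0 (w 0)`, `step 1 (w 1)`, …. -/
def runSteps (step : ℕ → Bool → Config n → Config n) :
    (K : ℕ) → (Fin K → Bool) → Config n → Config n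
  | 0, _, c => c
  | K + 1, w, c => step K (w (Fin.last K)) (runSteps step K (fun j => w j.castSucc) c)

theorem sum_snoc {M : Type*} [AddCommMonoid M] {K : ℕ} (F : (Fin (K + 1) → Bool) → M) :
    ∑ w, F w = ∑ b, ∑ w : Fin K → Bool, F (Fin.snoc (α := fun _ => Bool) w b) := by
  rw [← (Fin.snocEquiv fun _ : Fin (K + 1) => Bool).sum_comp F, Fintype.sum_prod_type]
  rfl

/-- The loop is expanded into a sum over all outcome strings. The normalisations between
measurements cancel, and only the final squared norm of each branch remains. -/
theorem sqNorm_mul_wp_iterateM {body : ℕ → Config n → PMF (Config n)}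
    {step : ℕ → Bool → Config n → Config n} {K : ℕ}
    (h : ∀ k < K, ∀ c φ, (sqNorm c.psi : ENNReal) * wp (body k c) φ =
      ∑ b, (sqNorm (step k b c).psi : ENNReal) * φ (step k b c))
    {c : Config n} {ψ : Amp n} (hψ : c.psi = ψ) (φ : Config n → ENNReal) :
    (sqNorm ψ : ENNReal) * wp (iterateM body K c) φ =
      ∑ w, (sqNorm (runSteps step K w c).psi : ENNReal) * φ (runSteps step K w c) := by
  subst hψ
  induction K generalizing φ with
  | zero => simp [iterateM, runSteps]
  | succ K ih =>
    rw [iterateM, wp_bind, ih (fun k hk => h k (hk.trans K.lt_succ_self)), sum_snoc,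
      Finset.sum_comm]
    refine Finset.sum_congr rfl fun w _ => ?_
    rw [h K K.lt_succ_self]
    simp [runSteps]

/-- Projections in the computational basis compose to the restriction to basis states that agree
with all recorded bits. -/
theorem runSteps_psi {step : ℕ → Bool → Config n → Config n}
    (h : ∀ k (hk : k < n + 1) b c, (step k b c).psi = project ⟨k, hk⟩ b c.psi)
    {K : ℕ} (hK : K ≤ n) (w : Fin K → Bool) (c : Config n) (z : Fin (n + 1) → Bool) :
    (runSteps step K w c).psi z =
      if ∀ j : Fin K, z (Fin.castLE hK j).castSucc = w j then c.psi z else 0 := by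
  induction K with
  | zero => simp [runSteps]
  | succ K ih =>
    rw [runSteps, h K (by omega), project, ih (by omega)]
    by_cases h1 : ∀ j : Fin K, z (Fin.castLE hK j.castSucc).castSucc = w j.castSucc
    · by_cases h2 : z ⟨K, by omega⟩ = w (Fin.last K)
      · rw [if_pos h2, if_pos (by exact h1), if_pos]
        exact Fin.lastCases h2 h1
      · rw [if_neg h2, if_neg]
        exact fun hc => h2 (hc (Fin.last K))
    · rw [if_neg (c := ∀ j : Fin K, _) (by exact h1), ite_self, if_neg]
      exact fun hc => h1 fun j => hc j.castSucc

/-- Assembling a basis state of the register from `x` and the last bit. -/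
def basis (x : Fin n → Bool) (b : Bool) : Fin (n + 1) → Bool := Fin.snoc (α := fun _ => Bool) x b

@[simp] theorem basis_castSucc (x : Fin n → Bool) (b : Bool) (i : Fin n) :
    basis x b i.castSucc = x i := by simp [basis]

@[simp] theorem basis_last (x : Fin n → Bool) (b : Bool) : basis x b (Fin.last n) = b := by
  simp [basis]

theorem sum_basis {M : Type*} [AddCommMonoid M] (F : (Fin (n + 1) → Bool) → M) :
    ∑ z, F z = ∑ b, ∑ x, F (basis x b) := sum_snoc F

theorem sqNorm_eq_sum_basis (ψ : Amp n) :
    sqNorm ψ = ∑ b, ∑ x, ‖ψ (basis x b)‖₊ ^ 2 := sum_basis _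

theorem sqNorm_project_last (ψ : Amp n) (b : Bool) :
    sqNorm (project (Fin.last n) b ψ) = ∑ x, ‖ψ (basis x b)‖₊ ^ 2 := by
  rw [sqNorm_eq_sum_basis, Finset.sum_eq_single b]
  · simp [project]
  · intro b' _ hb
    simp [project, hb]
  · simp

/-- With the last qubit and all others measured, a single basis state survives, so the weight of a
branch is one squared amplitude. -/
theorem sqNorm_runSteps {step : ℕ → Bool → Config n → Config n}
    (h : ∀ k (hk : k < n + 1) b c, (step k b c).psi = project ⟨k, hk⟩ b c.psi)
    (w : Fin n → Bool) {c : Config n} {b : Bool} {ψ : Amp n}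
    (hc : c.psi = project (Fin.last n) b ψ) :
    sqNorm (runSteps step n w c).psi = ‖ψ (basis w b)‖₊ ^ 2 := by
  rw [sqNorm, Finset.sum_eq_single (basis w b)]
  · rw [runSteps_psi h le_rfl, if_pos (by simp), hc, project, if_pos (by simp)]
  · intro z _ hz
    rw [runSteps_psi h le_rfl, hc, project]
    split_ifs with h1 h2
    · refine absurd ?_ hz
      funext j
      induction j using Fin.lastCases with
      | last => simpa using h2
      | cast j => simpa using h1 j
    · simp
    · simp
  · simp

end Config

end measurement

/-! ## Hadamard gates on all qubits -/

section hadamard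

variable {n : ℕ}

/-- The entry `(-1)^{ab}` of `√2 H`. -/
def hsign (a b : Bool) : ℝ := if a && b then -1 else 1

/-- The factor for qubit `j` in the matrix of the Hadamard gates on the qubits below `k`. -/
def hadFactor (k j : ℕ) (a b : Bool) : ℝ :=
  if j < k then hsign a b else if a = b then 1 else 0

/-- The state after Hadamard gates on the first `k` qubits. -/
noncomputable def hadState (k : ℕ) (ψ : Amp n) : Amp n := fun z =>
  (∑ y, ψ y * ((∏ j : Fin (n + 1), hadFactor k j (z j) (y j) : ℝ) : ℂ)) / ((√2 : ℝ) : ℂ) ^ k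

theorem hadState_zero (ψ : Amp n) : hadState 0 ψ = ψ := by
  funext z
  have h : ∀ y, (∏ j : Fin (n + 1), hadFactor 0 j (z j) (y j)) = if z = y then 1 else 0 := by
    intro y
    split_ifs with hzy
    · subst hzy; simp [hadFactor]
    · obtain ⟨j, hj⟩ := Function.ne_iff.mp hzy
      exact Finset.prod_eq_zero (Finset.mem_univ j) (by simp [hadFactor, hj])
  simp only [hadState, h, pow_zero, div_one]
  rw [Finset.sum_eq_single z]
  · simp
  · intro y _ hy
    simp [hy.symm]
  · simp

/-- In `hadState k` the factor for qubit k is still a Kronecker delta, which selects one of the two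
summands of the gate; together they form the factor `hsign`. -/
theorem gateH_hadState {k : ℕ} (hk : k < n + 1) (ψ : Amp n) :
    gateH k (hadState k ψ) = hadState (k + 1) ψ := by
  funext z
  set q : Fin (n + 1) := ⟨k, hk⟩ with hq
  have h1 : ∀ (v : Bool) (y : Fin (n + 1) → Bool), ∏ j : Fin (n + 1), hadFactor k j (Function.update z q v j) (y j) =
      (if v = y q then 1 else 0) *
        ∏ j ∈ Finset.univ.erase q, hadFactor k j (z j) (y j) := by
    intro v y
    rw [← Finset.mul_prod_erase _ _ (Finset.mem_univ q)]
    congr 1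
    · simp [hadFactor, hq]
    · exact Finset.prod_congr rfl fun j hj => by
        rw [Function.update_of_ne (Finset.ne_of_mem_erase hj)]
  have h2 : ∀ y : Fin (n + 1) → Bool, ∏ j : Fin (n + 1), hadFactor (k + 1) j (z j) (y j) =
      hsign (z q) (y q) * ∏ j ∈ Finset.univ.erase q, hadFactor k j (z j) (y j) := by
    intro y
    rw [← Finset.mul_prod_erase _ _ (Finset.mem_univ q)]
    congr 1
    · simp [hadFactor, hq]
    · refine Finset.prod_congr rfl fun j hj => ?_
      have : (j : ℕ) ≠ k := fun h => Finset.ne_of_mem_erase hj (Fin.ext h)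
      unfold hadFactor
      rw [if_congr (show (j : ℕ) < k + 1 ↔ (j : ℕ) < k by omega) rfl rfl]
  rw [gateH, dif_pos hk]
  simp only [hadState, ← hq, h1, h2]
  rw [mul_div_assoc', ← add_div, div_div, pow_succ, Finset.mul_sum, ← Finset.sum_add_distrib]
  congr 1
  refine Finset.sum_congr rfl fun y _ => ?_
  cases z q <;> cases y q <;> simp [hsign]

/-- The set with a given indicator string. -/
def bitSet (w : Fin n → Bool) : Finset (Fin n) := Finset.univ.filter fun i => w i = true

theorem sum_bitSet {M : Type*} [AddCommMonoid M] (F : Finset (Fin n) → M) :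
    ∑ w, F (bitSet w) = ∑ S, F S := by
  let e : (Fin n → Bool) ≃ Finset (Fin n) :=
    { toFun := bitSet
      invFun := fun S i => decide (i ∈ S)
      left_inv := fun w => by funext i; simp [bitSet]
      right_inv := fun S => by ext i; simp [bitSet] }
  exact e.sum_comp F

theorem sum_ite_bitSet (w : Fin n → Bool) :
    ∑ j, (if w j then (1 : ℝ) else 0) = (bitSet w).card := by
  simp [bitSet]

theorem sqrt_two_pow (n : ℕ) : √(2 ^ n : ℝ) = √2 ^ n := by
  rw [Real.sqrt_eq_iff_mul_self_eq (by positivity) (by positivity), ← mul_pow,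
    Real.mul_self_sqrt (by norm_num)]

/-- The principle of Fourier sampling: the phase from the last qubit is (-1)^f if its bit is 1 and
trivial if it is 0, and the other n qubits contribute the character of the set. So b = 1 yields the
coefficients of g and b = 0 those of the constant 1. -/
theorem hadState_functionState (f : (Fin n → Bool) → Bool) (w : Fin n → Bool) (b : Bool) :
    hadState (n + 1) (functionState f) (Config.basis w b) =
      ((cubeFourier (fun x => hsign b (f x)) (bitSet w) / √2 : ℝ) : ℂ) := by
  have hp : ∀ x : Fin n → Bool, ∏ i, hsign (w i) (x i) = ∏ i ∈ bitSet w, bsign (x i) := by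
    intro x
    rw [bitSet, Finset.prod_filter]
    refine Finset.prod_congr rfl fun i _ => ?_
    cases w i <;> cases x i <;> simp [hsign]
  have h : ∀ x b', (∏ j : Fin (n + 1), hadFactor (n + 1) j (Config.basis w b j)
      (Config.basis x b' j)) = (∏ i ∈ bitSet w, bsign (x i)) * hsign b b' := by
    intro x b'
    rw [Fin.prod_univ_castSucc, ← hp]
    simp [hadFactor]
  have hs : √(2 ^ n : ℝ) * √2 ^ (n + 1) = 2 ^ n * √2 := by
    rw [sqrt_two_pow, pow_succ, ← mul_assoc, ← mul_pow, Real.mul_self_sqrt (by norm_num)]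
  rw [hadState, Config.sum_basis, Finset.sum_comm]
  have hx : ∀ x, ∑ b', functionState f (Config.basis x b') *
      ((∏ j : Fin (n + 1), hadFactor (n + 1) j (Config.basis w b j)
        (Config.basis x b' j) : ℝ) : ℂ) =
      ((hsign b (f x) * (∏ i ∈ bitSet w, bsign (x i)) / √(2 ^ n) : ℝ) : ℂ) := by
    intro x
    rw [Finset.sum_eq_single (f x)]
    · rw [h]
      simp only [functionState, Config.basis_last, Config.basis_castSucc, if_true]
      rw [← Complex.ofReal_mul]
      congr 1
      ring
    · intro b' _ hb
      simp [functionState, hb]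
    · simp
  simp_rw [hx]
  rw [← Complex.ofReal_sum, ← Complex.ofReal_pow, ← Complex.ofReal_div, ← Finset.sum_div,
    div_div, hs, cubeFourier_eq, div_div]

theorem nnnorm_hadState_sq (f : (Fin n → Bool) → Bool) (w : Fin n → Bool) (b : Bool) :
    ((‖hadState (n + 1) (functionState f) (Config.basis w b)‖₊ ^ 2 : ℝ≥0) : ENNReal) =
      ENNReal.ofReal (cubeFourier (fun x => hsign b (f x)) (bitSet w) ^ 2 / 2) := by
  rw [hadState_functionState, ENNReal.ofReal]
  congr 1
  rw [← NNReal.coe_inj, Real.coe_toNNReal _ (by positivity)]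
  simp [div_pow]

/-- By Parseval each outcome of the last qubit has probability 1/2, whatever f is. -/
theorem sum_hadState_sq (f : (Fin n → Bool) → Bool) (b : Bool) :
    ((∑ w, ‖hadState (n + 1) (functionState f) (Config.basis w b)‖₊ ^ 2 : ℝ≥0) : ENNReal) =
      ENNReal.ofReal (1 / 2) := by
  rw [ENNReal.ofNNReal_finsetSum]
  simp_rw [nnnorm_hadState_sq]
  rw [sum_bitSet fun S => ENNReal.ofReal (cubeFourier (fun x => hsign b (f x)) S ^ 2 / 2),
    ← ENNReal.ofReal_sum_of_nonneg fun S _ => by positivity, ← Finset.sum_div, parseval, cubeExp]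
  congr 1
  have : ∀ x, hsign b (f x) ^ 2 = 1 := fun x => by cases b <;> cases f x <;> simp [hsign]
  simp [this]

theorem sqNorm_hadState (f : (Fin n → Bool) → Bool) :
    (sqNorm (hadState (n + 1) (functionState f)) : ENNReal) = 1 := by
  rw [Config.sqNorm_eq_sum_basis, ENNReal.ofNNReal_finsetSum, Fintype.sum_bool, sum_hadState_sq,
    sum_hadState_sq, ← ENNReal.ofReal_add (by norm_num) (by norm_num)]
  norm_num

theorem nnnorm_functionState_sq (f : (Fin n → Bool) → Bool) (x : Fin n → Bool) (b : Bool) :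
    ((‖functionState f (Config.basis x b)‖₊ ^ 2 : ℝ≥0) : ENNReal) =
      if b = f x then ENNReal.ofReal (1 / 2 ^ n) else 0 := by
  unfold functionState
  simp only [Config.basis_last, Config.basis_castSucc]
  split_ifs
  · rw [ENNReal.ofReal]
    congr 1
    rw [← NNReal.coe_inj, Real.coe_toNNReal _ (by positivity)]
    simp
  · simp

theorem sqNorm_functionState (f : (Fin n → Bool) → Bool) :
    (sqNorm (functionState f) : ENNReal) = 1 := by
  rw [Config.sqNorm_eq_sum_basis, Finset.sum_comm]
  simp only [ENNReal.ofNNReal_finsetSum, nnnorm_functionState_sq, Finset.sum_ite_eq', Finset.mem_univ,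
    if_true]
  rw [← ENNReal.ofReal_sum_of_nonneg fun x _ => by positivity]
  simp

end hadamard

/-! ## Values of expressions -/

section eval

variable (reg : Var → ℝ) (mem : ℕ → ℝ) (a b : CExpr)

@[simp] theorem eval_var (v : Var) : CExpr.eval reg mem (CExpr.var v) = reg v := rfl
@[simp] theorem eval_zero : CExpr.eval reg mem 0 = 0 := Nat.cast_zero
@[simp] theorem eval_one : CExpr.eval reg mem 1 = 1 := Nat.cast_one
@[simp] theorem eval_two : CExpr.eval reg mem 2 = 2 := Nat.cast_ofNat
@[simp] theorem eval_three : CExpr.eval reg mem 3 = 3 := Nat.cast_ofNat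
@[simp] theorem eval_four : CExpr.eval reg mem 4 = 4 := Nat.cast_ofNat
@[simp] theorem eval_eighteen : CExpr.eval reg mem 18 = 18 := Nat.cast_ofNat
@[simp] theorem eval_add :
    CExpr.eval reg mem (a + b) = CExpr.eval reg mem a + CExpr.eval reg mem b := rfl
@[simp] theorem eval_sub :
    CExpr.eval reg mem (a - b) = CExpr.eval reg mem a - CExpr.eval reg mem b := rfl
@[simp] theorem eval_mul :
    CExpr.eval reg mem (a * b) = CExpr.eval reg mem a * CExpr.eval reg mem b := rfl
@[simp] theorem eval_div :
    CExpr.eval reg mem (a / b) = CExpr.eval reg mem a / CExpr.eval reg mem b := rfl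
@[simp] theorem eval_arr :
    CExpr.eval reg mem (CExpr.arr a) = mem ⌊CExpr.eval reg mem a⌋₊ := rfl
@[simp] theorem eval_log :
    CExpr.eval reg mem (CExpr.log a) = Real.log (CExpr.eval reg mem a) := rfl
@[simp] theorem eval_ceil :
    CExpr.eval reg mem (CExpr.ceil a) = (⌈CExpr.eval reg mem a⌉ : ℝ) := rfl

end eval

namespace Config

variable {n : ℕ} (c : Config n) (k : ℕ) (v : Var) (r : ℝ)

@[simp] theorem tick_reg : (c.tick k).reg = c.reg := rfl
@[simp] theorem tick_mem : (c.tick k).mem = c.mem := rfl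
@[simp] theorem tick_psi : (c.tick k).psi = c.psi := rfl
@[simp] theorem set_reg : (c.set v r).reg = Function.update c.reg v r := rfl
@[simp] theorem set_mem : (c.set v r).mem = c.mem := rfl
@[simp] theorem set_psi : (c.set v r).psi = c.psi := rfl
@[simp] theorem val_eq (e : CExpr) : c.val e = e.eval c.reg c.mem := rfl
@[simp] theorem idx_eq (e : CExpr) : c.idx e = ⌊e.eval c.reg c.mem⌋₊ := rfl

/-- The configuration after loading a copy of the function state. -/
noncomputable def load (f : (Fin n → Bool) → Bool) : Config n :=
  { c.tick (1 + (n + 1)) with psi := functionState f, copies := c.copies + 1 }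

@[simp] theorem load_reg (f : (Fin n → Bool) → Bool) : (c.load f).reg = c.reg := rfl
@[simp] theorem load_mem (f : (Fin n → Bool) → Bool) : (c.load f).mem = c.mem := rfl
@[simp] theorem load_psi (f : (Fin n → Bool) → Bool) : (c.load f).psi = functionState f := rfl

theorem exec_fresh (f : (Fin n → Bool) → Bool) :
    Prog.exec f .fresh c = PMF.pure (c.load f) := rfl

theorem collapse_reg {q : ℕ} (hq : q < n + 1) (b : Bool) :
    (c.collapse q v b).reg = Function.update c.reg v (if b then 1 else 0) := by
  simp [collapse, hq]

theorem collapse_psi {q : ℕ} (hq : q < n + 1) (b : Bool) :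
    (c.collapse q v b).psi = project ⟨q, hq⟩ b c.psi := by
  simp [collapse, hq]

theorem collapse_mem (q : ℕ) (b : Bool) : (c.collapse q v b).mem = c.mem := by
  unfold collapse
  split_ifs <;> rfl

end Config

/-! ### The law of a single Fourier sampling attempt -/

section attempt

variable {n : ℕ} {f : (Fin n → Bool) → Bool}

theorem hadamards_psi {c c' : Config n} (hn : c.reg .n = n)
    (h : c' ∈ ((Prog.loop .i (Var.n + 1) (.had Var.i)).exec f c).support) :
    c'.psi = hadState (n + 1) c.psi := by
  have hidx : c.idx (Var.n + 1) = n + 1 := by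
    simp only [Config.idx_eq, eval_add, eval_var, eval_one, hn]
    exact_mod_cast Nat.floor_natCast (n + 1)
  simp only [Prog.exec, hidx] at h
  refine iterateM_support (P := fun k c' => c'.psi = hadState k c.psi) ?_
    (hadState_zero _).symm c' h
  intro k hk c1 h1 c2 h2
  rw [PMF.mem_support_pure_iff] at h2
  subst h2
  rw [← gateH_hadState hk, ← h1]
  simp

/-- One pass through the loop that measures the bits of a Fourier sample. -/
noncomputable def weightStep (k : ℕ) (b : Bool) (c : Config n) : Config n :=
  -- The ticks reproduce the charges of `Prog.exec`: 1 for the pass, 2 for the measurement, 4 for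
  -- the assignment. The configurations have to agree in every field, including the counter.
  let c' := (((c.set .i k).tick 1).tick 2).collapse k .bit b
  (c'.set .weight (c'.reg .weight + c'.reg .bit)).tick 4

theorem weightStep_psi (k : ℕ) (hk : k < n + 1) (b : Bool) (c : Config n) :
    (weightStep k b c).psi = project ⟨k, hk⟩ b c.psi := by
  simp [weightStep, Config.collapse_psi, hk]

theorem weightStep_weight {k : ℕ} (hk : k < n + 1) (b : Bool) (c : Config n) :
    (weightStep k b c).reg .weight = c.reg .weight + if b then 1 else 0 := by
  simp [weightStep, Config.collapse_reg, hk]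

theorem weightStep_reg {k : ℕ} (hk : k < n + 1) (b : Bool) (c : Config n) {v : Var}
    (h1 : v ≠ .i) (h2 : v ≠ .bit) (h3 : v ≠ .weight) :
    (weightStep k b c).reg v = c.reg v := by
  simp [weightStep, Config.collapse_reg, hk, h1, h2, h3]

theorem runSteps_weightStep_weight {K : ℕ} (hK : K ≤ n) (w : Fin K → Bool) (c : Config n) :
    (Config.runSteps weightStep K w c).reg .weight =
      c.reg .weight + ∑ j, if w j then 1 else 0 := by
  induction K with
  | zero => simp [Config.runSteps]
  | succ K ih =>
    rw [Config.runSteps, weightStep_weight (by omega), ih (by omega), Fin.sum_univ_castSucc]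
    ring

theorem runSteps_weightStep_reg {K : ℕ} (hK : K ≤ n) (w : Fin K → Bool) (c : Config n)
    {v : Var} (h1 : v ≠ .i) (h2 : v ≠ .bit) (h3 : v ≠ .weight) :
    (Config.runSteps weightStep K w c).reg v = c.reg v := by
  induction K with
  | zero => rfl
  | succ K ih => rw [Config.runSteps, weightStep_reg (by omega) _ _ h1 h2 h3, ih (by omega)]

theorem wp_weightBody {k : ℕ} (hk : k < n) (c : Config n) (φ : Config n → ENNReal) :
    (sqNorm c.psi : ENNReal) *
        wp ((Prog.seq (.meas Var.i .bit) (.assign .weight (Var.weight + Var.bit))).exec f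
          ((c.set .i k).tick 1)) φ =
      ∑ b, (sqNorm (weightStep k b c).psi : ENNReal) * φ (weightStep k b c) := by
  have hidx : ((c.set .i k).tick 1).idx Var.i = k := by simp
  simp only [Prog.exec, wp_bind, wp_pure]
  rw [hidx]
  exact Config.sqNorm_mul_wp_measure (((c.set .i k).tick 1).tick 2) (by omega) _ _

/-- The part of an attempt that follows the Hadamard gates. -/
theorem wp_measure_fourier {c : Config n} (hn : c.reg .n = n)
    (hpsi : c.psi = hadState (n + 1) (functionState f)) (Φ : ℝ → ℝ → ENNReal) :
    wp ((Prog.seq (.meas Var.n .label) (.ifLE 1 Var.label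
      (.seq (.assign .weight 0) (.seq
        (.loop .i Var.n
          (.seq (.meas Var.i .bit) (.assign .weight (Var.weight + Var.bit))))
        (.ifLE (Var.found + 1) Var.m2
          (.seq (.assign .total (Var.total + Var.weight)) (.assign .found (Var.found + 1)))
          .skip)))
      .skip)).exec f c) (fun c' => Φ (c'.reg .found) (c'.reg .total)) =
      ENNReal.ofReal (1 / 2) * Φ (c.reg .found) (c.reg .total) +
        ∑ S, ENNReal.ofReal (cubeFourier (signFn f) S ^ 2 / 2) *
          if c.reg .found + 1 ≤ c.reg .m2
          then Φ (c.reg .found + 1) (c.reg .total + S.card)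
          else Φ (c.reg .found) (c.reg .total) := by
  -- The state has squared norm 1; inserting this factor makes the unnormalised measurement rules
  -- applicable.
  rw [← one_mul (wp _ _), ← sqNorm_hadState f, ← hpsi]
  have hidx : ∀ c2 : Config n, c2.reg .n = n → c2.idx Var.n = n := by
    intro c2 h2
    simp [h2]
  have hamp : ∀ w, ((‖c.psi (Config.basis w true)‖₊ ^ 2 : ℝ≥0) : ENNReal) =
      ENNReal.ofReal (cubeFourier (signFn f) (bitSet w) ^ 2 / 2) := by
    intro w
    rw [hpsi, nnnorm_hadState_sq]
    simp only [hsign, Bool.true_and]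
    rfl
  simp only [Prog.exec, wp_bind, hidx c hn]
  refine (Config.sqNorm_mul_wp_measure (c.tick 2) n.lt_succ_self _ _).trans ?_
  have hreg := fun b => Config.collapse_reg (c.tick 2) .label n.lt_succ_self b
  have hproj := fun b => Config.collapse_psi (c.tick 2) .label n.lt_succ_self b
  rw [Fintype.sum_bool, add_comm]
  congr 1
  · have : sqNorm ((c.tick 2).collapse n .label false).psi =
        ∑ x, ‖c.psi (Config.basis x false)‖₊ ^ 2 := by
      rw [hproj]; exact Config.sqNorm_project_last _ _
    rw [this, hpsi, sum_hadState_sq, if_neg]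
    · simp [hreg]
    · simp [hreg]
  · rw [if_pos (by simp [hreg])]
    set c1 := (c.tick 2).collapse n .label true with hc1
    simp only [wp_bind, wp_pure]
    have hn1 : c1.reg .n = n := by simp [hc1, hreg, hn]
    rw [hidx _ (by simp [hn1])]
    refine (Config.sqNorm_mul_wp_iterateM (step := weightStep)
      (fun k hk c φ => by simpa only [Prog.exec] using wp_weightBody (f := f) hk c φ) (by rfl) _).trans ?_
    rw [← sum_bitSet fun S => ENNReal.ofReal (cubeFourier (signFn f) S ^ 2 / 2) *
          if c.reg .found + 1 ≤ c.reg .m2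
          then Φ (c.reg .found + 1) (c.reg .total + S.card)
          else Φ (c.reg .found) (c.reg .total)]
    refine Finset.sum_congr rfl fun w _ => ?_
    rw [Config.sqNorm_runSteps weightStep_psi w (b := true) (ψ := c.psi), hamp]
    swap
    · exact hproj true
    congr 1
    simp only [Config.val_eq, eval_add, eval_var, eval_one, Config.tick_reg]
    rw [runSteps_weightStep_reg le_rfl w _ (v := .found) (by decide) (by decide) (by decide),
      runSteps_weightStep_reg le_rfl w _ (v := .m2) (by decide) (by decide) (by decide)]
    have hF : c1.reg .found = c.reg .found := by simp [hc1, hreg]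
    have hM : c1.reg .m2 = c.reg .m2 := by simp [hc1, hreg]
    have hT : c1.reg .total = c.reg .total := by simp [hc1, hreg]
    simp only [Config.tick_reg, Config.set_reg, ne_eq, reduceCtorEq, not_false_eq_true,
      Function.update_of_ne, hF, hM]
    split_ifs
    · simp only [wp_bind, wp_pure, Config.tick_reg, Config.set_reg, Function.update_self, ne_eq, reduceCtorEq, not_false_eq_true,
        Function.update_of_ne]
      rw [runSteps_weightStep_reg le_rfl w _ (v := .found) (by decide) (by decide) (by decide),
        runSteps_weightStep_reg le_rfl w _ (v := .total) (by decide) (by decide) (by decide),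
        runSteps_weightStep_weight le_rfl, sum_ite_bitSet]
      simp [hF, hT]
    · simp only [wp_pure, Config.tick_reg]
      rw [runSteps_weightStep_reg le_rfl w _ (v := .found) (by decide) (by decide) (by decide),
        runSteps_weightStep_reg le_rfl w _ (v := .total) (by decide) (by decide) (by decide)]
      simp [hF, hT]

/-- For the tail bounds only `found` and `total` matter, and on them an attempt is an explicit
Markov kernel: nothing happens with probability 1/2, and S is obtained with probability ĝ(S)²/2 and
counted while the quota lasts. -/
theorem wp_fourierAttempt {c : Config n} (hn : c.reg .n = n) (Φ : ℝ → ℝ → ENNReal) :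
    wp (fourierAttempt.exec f c) (fun c' => Φ (c'.reg .found) (c'.reg .total)) =
      ENNReal.ofReal (1 / 2) * Φ (c.reg .found) (c.reg .total) +
        ∑ S, ENNReal.ofReal (cubeFourier (signFn f) S ^ 2 / 2) *
          if c.reg .found + 1 ≤ c.reg .m2
          then Φ (c.reg .found + 1) (c.reg .total + S.card)
          else Φ (c.reg .found) (c.reg .total) := by
  rw [fourierAttempt, Prog.exec, wp_bind, Config.exec_fresh, wp_pure, Prog.exec, wp_bind]
  refine wp_eq_of_support fun c' hc' => ?_
  have hk : ∀ v, v ≠ .i → c'.reg v = c.reg v := fun v hv =>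
    (Prog.reg_eq_of_keeps (v := v) (p := .loop .i (Var.n + 1) (.had Var.i)) f
      (by simp [Prog.keeps, hv.symm]) hc').trans (by rw [Config.load_reg])
  have h := wp_measure_fourier (f := f) (c := c') ((hk .n (by decide)).trans hn)
    (hadamards_psi (c := c.load f) (by rw [Config.load_reg, hn]) hc') Φ
  rwa [hk .found (by decide), hk .total (by decide), hk .m2 (by decide)] at h

end attempt

/-! ## Classical samples -/

section sample

variable {n : ℕ} {f : (Fin n → Bool) → Bool}

/-- One pass through the loop that measures the bits of a classical sample. -/
noncomputable def sampleStep (k : ℕ) (b : Bool) (c : Config n) : Config n :=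
  let c' := (((c.set .i k).tick 1).tick 2).collapse k .bit b
  { c'.tick 16 with
    mem := Function.update c'.mem k
      (c'.mem k + (1 - 2 * c'.reg .bit) * (1 - 2 * c'.reg .label)) }

theorem sampleStep_psi (k : ℕ) (hk : k < n + 1) (b : Bool) (c : Config n) :
    (sampleStep k b c).psi = project ⟨k, hk⟩ b c.psi := by
  simp [sampleStep, Config.collapse_psi, hk]

theorem sampleStep_label {k : ℕ} (hk : k < n + 1) (b : Bool) (c : Config n) :
    (sampleStep k b c).reg .label = c.reg .label := by
  simp [sampleStep, Config.collapse_reg, hk]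

theorem sampleStep_mem {k : ℕ} (hk : k < n + 1) (b : Bool) (c : Config n) :
    (sampleStep k b c).mem =
      Function.update c.mem k (c.mem k + bsign b * (1 - 2 * c.reg .label)) := by
  cases b
  · simp [sampleStep, Config.collapse_reg, Config.collapse_mem, hk]
  · simp [sampleStep, Config.collapse_reg, Config.collapse_mem, hk]; norm_num

theorem runSteps_sampleStep_label {K : ℕ} (hK : K ≤ n) (w : Fin K → Bool) (c : Config n) :
    (Config.runSteps sampleStep K w c).reg .label = c.reg .label := by
  induction K with
  | zero => rfl
  | succ K ih => rw [Config.runSteps, sampleStep_label (by omega), ih (by omega)]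

theorem runSteps_sampleStep_mem {K : ℕ} (hK : K ≤ n) (w : Fin K → Bool) (c : Config n) (m : ℕ) :
    (Config.runSteps sampleStep K w c).mem m =
      if h : m < K then c.mem m + bsign (w ⟨m, h⟩) * (1 - 2 * c.reg .label) else c.mem m := by
  induction K with
  | zero => simp [Config.runSteps]
  | succ K ih =>
    rw [Config.runSteps, sampleStep_mem (by omega), runSteps_sampleStep_label (by omega)]
    by_cases hm : m = K
    · subst hm
      rw [Function.update_self, ih (by omega), dif_neg (lt_irrefl _), dif_pos m.lt_succ_self]
      rfl
    · rw [Function.update_of_ne hm, ih (by omega)]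
      by_cases h : m < K
      · rw [dif_pos h, dif_pos (h.trans K.lt_succ_self)]
        rfl
      · rw [dif_neg h, dif_neg (by omega)]

theorem wp_sampleBody {k : ℕ} (hk : k < n) (c : Config n) (φ : Config n → ENNReal) :
    (sqNorm c.psi : ENNReal) *
        wp ((Prog.seq (.meas Var.i .bit)
          (.store Var.i (.arr Var.i + (1 - 2 * Var.bit) * (1 - 2 * Var.label)))).exec f
          ((c.set .i k).tick 1)) φ =
      ∑ b, (sqNorm (sampleStep k b c).psi : ENNReal) * φ (sampleStep k b c) := by
  have hidx : ((c.set .i k).tick 1).idx Var.i = k := by simp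
  simp only [Prog.exec, wp_bind, wp_pure]
  rw [hidx]
  refine (Config.sqNorm_mul_wp_measure (((c.set .i k).tick 1).tick 2) (by omega) _ _).trans ?_
  refine Finset.sum_congr rfl fun b _ => ?_
  have hi : ((((c.set .i k).tick 1).tick 2).collapse k .bit b).reg .i = k := by
    simp [Config.collapse_reg, hk.trans n.lt_succ_self]
  congr 2
  simp only [sampleStep, Config.idx_eq, Config.val_eq, eval_add, eval_mul, eval_sub, eval_arr,
    eval_var, eval_one, eval_two, hi, Nat.floor_natCast]
  rfl

/-- The law of one memory cell is enough, because the coordinates are later combined by a union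
bound. -/
theorem wp_classicalSample {c : Config n} (hn : c.reg .n = n) (i : Fin n) (Φ : ℝ → ENNReal) :
    wp (classicalSample.exec f c) (fun c' => Φ (c'.mem i)) =
      ∑ x : Fin n → Bool,
        ENNReal.ofReal (1 / 2 ^ n) * Φ (c.mem i + bsign (x i) * bsign (f x)) := by
  rw [classicalSample, Prog.exec, wp_bind, Config.exec_fresh, wp_pure]
  have hn0 : (c.load f).reg .n = n := hn
  have hmem0 : (c.load f).mem = c.mem := rfl
  have hpsi0 : (c.load f).psi = functionState f := rfl
  generalize c.load f = c0 at hn0 hmem0 hpsi0 ⊢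
  rw [← one_mul (wp _ _), ← sqNorm_functionState f, ← hpsi0, ← hmem0]
  have hidx : ∀ c2 : Config n, c2.reg .n = n → c2.idx Var.n = n := by
    intro c2 h2
    simp [h2]
  simp only [Prog.exec, wp_bind, hidx c0 hn0]
  refine (Config.sqNorm_mul_wp_measure (c0.tick 2) n.lt_succ_self _ _).trans ?_
  have hreg := fun b => Config.collapse_reg (c0.tick 2) .label n.lt_succ_self b
  have hproj := fun b => Config.collapse_psi (c0.tick 2) .label n.lt_succ_self b
  have hmem := fun b => Config.collapse_mem (c0.tick 2) .label n b
  have hb : ∀ b : Bool, 1 - 2 * (if b then (1 : ℝ) else 0) = bsign b := by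
    intro b; cases b <;> norm_num
  have key : ∀ b, (sqNorm ((c0.tick 2).collapse n .label b).psi : ENNReal) *
      wp (iterateM (fun k c' => (Prog.seq (.meas Var.i .bit)
          (.store Var.i (.arr Var.i + (1 - 2 * Var.bit) * (1 - 2 * Var.label)))).exec f
          ((c'.set .i k).tick 1)) n (((c0.tick 2).collapse n .label b).tick 2))
        (fun c' => Φ (c'.mem i)) =
      ∑ x : Fin n → Bool, (if b = f x then ENNReal.ofReal (1 / 2 ^ n) else 0) *
        Φ (c0.mem i + bsign (x i) * bsign b) := by
    intro b
    refine (Config.sqNorm_mul_wp_iterateM (step := sampleStep)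
      (fun k hk c φ => wp_sampleBody (f := f) hk c φ) (by rfl) _).trans ?_
    refine Finset.sum_congr rfl fun x _ => ?_
    rw [Config.sqNorm_runSteps sampleStep_psi x (b := b) (ψ := c0.psi)]
    swap
    · exact hproj b
    rw [hpsi0, nnnorm_functionState_sq,
      runSteps_sampleStep_mem le_rfl, dif_pos i.is_lt]
    simp only [Config.tick_mem, Config.tick_reg, hreg, hmem, Function.update_self, hb]
  have hk : ∀ b, ((c0.tick 2).collapse n .label b).idx Var.n = n := by
    intro b
    exact hidx _ (by simp [hreg, hn0])
  simp only [hk]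
  simp only [Prog.exec] at key
  refine (Finset.sum_congr rfl fun b _ => key b).trans ?_
  rw [Finset.sum_comm]
  refine Finset.sum_congr rfl fun x _ => ?_
  rw [Finset.sum_eq_single (f x)]
  · simp
  · intro b _ h
    simp [h]
  · simp

end sample

/-! ## Tail bounds for the two sampling loops -/

section tails

variable {n : ℕ} {f : (Fin n → Bool) → Bool}

/-- Markov's inequality, with the threshold in exponential form. -/
theorem wp_ite_le {α : Type*} {μ : PMF α} {p : α → Prop} [DecidablePred p] {Φ : α → ENNReal} (b : ℝ)
    (h : ∀ a ∈ μ.support, p a → ENNReal.ofReal (Real.exp b) ≤ Φ a) :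
    wp μ (fun a => if p a then 1 else 0) ≤ ENNReal.ofReal (Real.exp (-b)) * wp μ Φ := by
  rw [← wp_const_mul]
  refine wp_mono fun a ha => ?_
  split_ifs with hp
  · calc (1 : ENNReal) = ENNReal.ofReal (Real.exp (-b)) * ENNReal.ofReal (Real.exp b) := by
          rw [← ENNReal.ofReal_mul (Real.exp_pos _).le, ← Real.exp_add]; simp
      _ ≤ _ := by gcongr; exact h a ha hp
  · exact zero_le

theorem fourierAttempt_keeps {v : Var}
    (hv : fourierAttempt.keeps v = true) {c c' : Config n}
    (h : c' ∈ (fourierAttempt.exec f c).support) : c'.reg v = c.reg v :=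
  Prog.reg_eq_of_keeps f hv h

/-- The invariant of the Fourier sampling loop. -/
def FourierInv (M : ℕ) (c : Config n) : Prop :=
  c.reg .n = n ∧ c.reg .m2 = M ∧ ∃ k : ℕ, k ≤ M ∧ c.reg .found = k

theorem FourierInv.set_ell {M : ℕ} {c : Config n} (h : FourierInv M c) (k : ℕ) :
    FourierInv M ((c.set .ell k).tick 1) := by
  simpa [FourierInv] using h

theorem sum_fourier_half_mul (f : (Fin n → Bool) → Bool) (x : ENNReal) :
    ENNReal.ofReal (1 / 2) * x +
      ∑ S, ENNReal.ofReal (cubeFourier (signFn f) S ^ 2 / 2) * x = x := by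
  rw [← Finset.sum_mul, ← ENNReal.ofReal_sum_of_nonneg fun S _ => by positivity,
    ← Finset.sum_div, sum_cubeFourier_sq_signFn, ← add_mul,
    ← ENNReal.ofReal_add (by norm_num) (by norm_num)]
  norm_num

/-- The exact law is applied to the indicator that `found` is not a natural number up to M; its
expectation is 0, so this never occurs. -/
theorem FourierInv.attempt {M : ℕ} {c c' : Config n} (h : FourierInv M c)
    (hc : c' ∈ (fourierAttempt.exec f c).support) : FourierInv M c' := by
  classical
  refine ⟨(fourierAttempt_keeps (by decide) hc).trans h.1,
    (fourierAttempt_keeps (by decide) hc).trans h.2.1, ?_⟩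
  have key := wp_fourierAttempt (f := f) h.1
    fun F _ => if ∃ k : ℕ, k ≤ M ∧ F = k then 0 else 1
  obtain ⟨k, hk, hF⟩ := h.2.2
  have h1 : ∃ k : ℕ, k ≤ M ∧ c.reg .found = k := ⟨k, hk, hF⟩
  rw [if_pos h1, Finset.sum_eq_zero, mul_zero, add_zero, wp_eq_zero_iff] at key
  · exact key c' hc
  · intro S _
    split_ifs with h2 h3
    · simp
    · refine absurd ⟨k + 1, ?_, by rw [hF]; push_cast; rfl⟩ h3
      rw [hF, h.2.1] at h2
      exact_mod_cast h2
    · simp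

/-- The exponential supermartingale for the sum of the weights. -/
noncomputable def weightPotential (f : (Fin n → Bool) → Bool) (t F T : ℝ) : ℝ :=
  Real.exp (t * (T - F * totalInfluence (signFn f)) - F * (t ^ 2 * n ^ 2 / 8))

/-- An uncounted attempt leaves the potential fixed. A counted one multiplies it by a factor of mean
at most 1, by Hoeffding's lemma for |S| ∈ [0, n]. -/
theorem wp_attempt_weightPotential (t : ℝ) {c : Config n} (hn : c.reg .n = n) :
    wp (fourierAttempt.exec f c)
        (fun c' => ENNReal.ofReal (weightPotential f t (c'.reg .found) (c'.reg .total))) ≤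
      ENNReal.ofReal (weightPotential f t (c.reg .found) (c.reg .total)) := by
  rw [wp_fourierAttempt hn fun F T => ENNReal.ofReal (weightPotential f t F T)]
  set F := c.reg .found
  set T := c.reg .total
  by_cases hF : F + 1 ≤ c.reg .m2
  · simp only [if_pos hF]
    have hoeff := sum_mul_exp_le (w := fun S => cubeFourier (signFn f) S ^ 2)
      (X := fun S : Finset (Fin n) => (S.card : ℝ)) (a := 0) (b := n) (fun S => sq_nonneg _)
      (sum_cubeFourier_sq_signFn f)
      (fun S => ⟨by positivity, by exact_mod_cast S.card_le_univ.trans (by simp)⟩) t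
    rw [sum_card_mul_cubeFourier_sq, sub_zero] at hoeff
    have e : ∀ S : Finset (Fin n), cubeFourier (signFn f) S ^ 2 / 2 *
        weightPotential f t (F + 1) (T + S.card) =
        weightPotential f t F T * Real.exp (-(t ^ 2 * n ^ 2 / 8)) / 2 *
          (cubeFourier (signFn f) S ^ 2 *
            Real.exp (t * (S.card - totalInfluence (signFn f)))) := by
      intro S
      have : weightPotential f t (F + 1) (T + S.card) = weightPotential f t F T *
          Real.exp (-(t ^ 2 * n ^ 2 / 8)) *
            Real.exp (t * (S.card - totalInfluence (signFn f))) := by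
        unfold weightPotential
        rw [← Real.exp_add, ← Real.exp_add]
        congr 1
        ring
      rw [this]
      ring
    have hW : ∀ F T, 0 ≤ weightPotential f t F T := fun _ _ => (Real.exp_pos _).le
    have hW0 := hW F T
    calc _ = ENNReal.ofReal (1 / 2 * weightPotential f t F T + ∑ S, cubeFourier (signFn f) S ^ 2 / 2 *
          weightPotential f t (F + 1) (T + S.card)) := by
          rw [ENNReal.ofReal_add (by positivity)
              (Finset.sum_nonneg fun S _ => mul_nonneg (by positivity) (hW _ _)),
            ENNReal.ofReal_mul (by norm_num), ENNReal.ofReal_sum_of_nonneg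
              (fun S _ => mul_nonneg (by positivity) (hW _ _))]
          congr 1
          exact Finset.sum_congr rfl fun S _ => (ENNReal.ofReal_mul (by positivity)).symm
      _ ≤ _ := by
          apply ENNReal.ofReal_le_ofReal
          simp_rw [e]
          rw [← Finset.mul_sum]
          calc _ ≤ 1 / 2 * weightPotential f t F T +
                weightPotential f t F T * Real.exp (-(t ^ 2 * n ^ 2 / 8)) / 2 *
                  Real.exp (t ^ 2 * n ^ 2 / 8) := by gcongr
            _ = 1 / 2 * weightPotential f t F T + weightPotential f t F T / 2 *
                (Real.exp (-(t ^ 2 * n ^ 2 / 8)) * Real.exp (t ^ 2 * n ^ 2 / 8)) := by ring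
            _ = weightPotential f t F T := by
                rw [← Real.exp_add, neg_add_cancel, Real.exp_zero]; ring
  · simp only [if_neg hF]
    exact (sum_fourier_half_mul f _).le

/-- The exponential potential that controls the number of sets found so far. -/
noncomputable def countPotential (M : ℕ) (F : ℝ) : ℝ :=
  -- The value 0 at the full quota keeps the potential contracting once `found` stops changing.
  if F = M then 0 else Real.exp (-(2 / 3) * F)

/-- The left side is exp(-a) cosh a with a = 1/3, and cosh a ≤ exp(a²/2) gives the exponent -1/3 +
1/18 = -5/18. -/
theorem half_add_exp_le : (1 + Real.exp (-(2 / 3))) / 2 ≤ Real.exp (-(5 / 18)) := by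
  have h := Real.cosh_le_exp_half_sq (1 / 3)
  have e : (1 + Real.exp (-(2 / 3))) / 2 = Real.exp (-(1 / 3)) * Real.cosh (1 / 3) := by
    rw [Real.cosh_eq, mul_div_assoc', mul_add, ← Real.exp_add, ← Real.exp_add]
    norm_num
  rw [e]
  calc _ ≤ Real.exp (-(1 / 3)) * Real.exp ((1 / 3) ^ 2 / 2) := by gcongr
    _ = _ := by rw [← Real.exp_add]; norm_num

theorem wp_attempt_countPotential {M : ℕ} {c : Config n} (h : FourierInv M c) :
    wp (fourierAttempt.exec f c)
        (fun c' => ENNReal.ofReal (countPotential M (c'.reg .found))) ≤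
      ENNReal.ofReal (Real.exp (-(5 / 18))) *
        ENNReal.ofReal (countPotential M (c.reg .found)) := by
  rw [wp_fourierAttempt h.1 fun F _ => ENNReal.ofReal (countPotential M F)]
  obtain ⟨k, hk, hF⟩ := h.2.2
  rw [h.2.1, hF]
  rcases hk.lt_or_eq with hk | rfl
  · have h1 : (k : ℝ) + 1 ≤ M := by exact_mod_cast hk
    have h2 : (k : ℝ) ≠ M := by exact_mod_cast hk.ne
    simp only [if_pos h1]
    rw [← Finset.sum_mul, ← ENNReal.ofReal_sum_of_nonneg fun S _ => by positivity,
      ← Finset.sum_div, sum_cubeFourier_sq_signFn, ← mul_add]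
    -- Only an inequality, because the potential drops to 0 if k + 1 = M.
    have h3 : countPotential M (k + 1) ≤ Real.exp (-(2 / 3)) * Real.exp (-(2 / 3) * k) := by
      unfold countPotential
      split_ifs
      · positivity
      · rw [← Real.exp_add]; apply le_of_eq; congr 1; ring
    have h4 : countPotential M k = Real.exp (-(2 / 3) * k) := if_neg h2
    have h5 : 0 ≤ countPotential M (k + 1) := by unfold countPotential; split_ifs <;> positivity
    rw [h4, ← ENNReal.ofReal_add (by positivity) h5, ← ENNReal.ofReal_mul (by norm_num),
      ← ENNReal.ofReal_mul (by positivity)]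
    apply ENNReal.ofReal_le_ofReal
    have := half_add_exp_le
    have hp := Real.exp_pos (-(2 / 3) * (k : ℝ))
    nlinarith
  · have h1 : ¬ (k : ℝ) + 1 ≤ k := by linarith
    simp only [if_neg h1]
    rw [sum_fourier_half_mul]
    simp [countPotential]

-- Below the quota the potential is at least exp(-2M/3), while its mean is at most exp(-5m/18). As M
-- ≤ m/3, Markov's inequality leaves the exponent 2m/9 - 5m/18 = -m/18.
open Classical in
theorem wp_fourierLoop_found {M m : ℕ} (hm : 3 * M ≤ m) {c : Config n} (hI : FourierInv M c)
    (hm1 : c.reg .m1 = m) (hF : c.reg .found = 0) :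
    wp ((Prog.loop .ell Var.m1 fourierAttempt).exec f c)
        (fun c' => if c'.reg .found ≠ M then 1 else 0) ≤
      ENNReal.ofReal (Real.exp (-(m / 18))) := by
  have hidx : c.idx Var.m1 = m := by simp [hm1]
  rw [Prog.exec, hidx]
  set μ := iterateM (fun k c' => fourierAttempt.exec f ((c'.set .ell k).tick 1)) m
    (c.tick (1 + CExpr.cost Var.m1)) with hμ
  have hI' : FourierInv M (c.tick (1 + CExpr.cost Var.m1)) := by simpa [FourierInv] using hI
  have hs : ∀ c' ∈ μ.support, FourierInv M c' :=
    iterateM_support (P := fun _ => FourierInv M)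
      (fun k _ c hc c' hc' => (hc.set_ell k).attempt hc') hI'
  have h1 : wp μ (fun c' => ENNReal.ofReal (countPotential M (c'.reg .found))) ≤
      ENNReal.ofReal (Real.exp (-(5 / 18))) ^ m *
        ENNReal.ofReal (countPotential M (c.reg .found)) :=
    wp_iterateM_le (I := FourierInv M) (fun k c hc c' hc' => (hc.set_ell k).attempt hc')
      (fun k c hc => by simpa using wp_attempt_countPotential (f := f) (hc.set_ell k)) m hI'
  have h2 : ENNReal.ofReal (countPotential M (c.reg .found)) ≤ 1 := by
    rw [← ENNReal.ofReal_one]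
    apply ENNReal.ofReal_le_ofReal
    rw [hF, countPotential]
    split_ifs <;> simp
  refine (wp_ite_le (-(2 / 3) * M) (Φ := fun c' : Config n =>
    ENNReal.ofReal (countPotential M (c'.reg .found))) ?_).trans ?_
  · intro c' hc' hne
    obtain ⟨k, hk, hF'⟩ := (hs c' hc').2.2
    apply ENNReal.ofReal_le_ofReal
    rw [countPotential, if_neg hne, Real.exp_le_exp, hF']
    have : (k : ℝ) ≤ M := by exact_mod_cast hk
    linarith
  · calc _ ≤ ENNReal.ofReal (Real.exp (-(-(2 / 3) * M))) *
          (ENNReal.ofReal (Real.exp (-(5 / 18))) ^ m * 1) := by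
          gcongr; exact h1.trans (by gcongr)
      _ = ENNReal.ofReal (Real.exp (2 / 3 * M - 5 / 18 * m)) := by
          rw [mul_one, ← ENNReal.ofReal_pow (Real.exp_pos _).le,
            ← ENNReal.ofReal_mul (Real.exp_pos _).le, ← Real.exp_nat_mul, ← Real.exp_add]
          congr 2
          ring
      _ ≤ _ := by
          apply ENNReal.ofReal_le_ofReal
          rw [Real.exp_le_exp]
          have : (3 : ℝ) * M ≤ m := by exact_mod_cast hm
          linarith

-- The sign s = ±1 covers both tails. The event includes that the quota is met, so that the
-- compensator in the potential has the fixed value for M sets.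
open Classical in
theorem wp_fourierLoop_weight (hn : 1 ≤ n) {M m : ℕ} {c : Config n} (hI : FourierInv M c)
    (hm1 : c.reg .m1 = m) (hF : c.reg .found = 0) (hT : c.reg .total = 0) {s e : ℝ}
    (hs : s ^ 2 = 1) (he : 0 < e) :
    wp ((Prog.loop .ell Var.m1 fourierAttempt).exec f c)
        (fun c' => if c'.reg .found = M ∧
          M * e ≤ s * (c'.reg .total - M * totalInfluence (signFn f)) then 1 else 0) ≤
      ENNReal.ofReal (Real.exp (-(2 * M * e ^ 2 / n ^ 2))) := by
  have hn' : (0 : ℝ) < n := by exact_mod_cast hn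
  have hidx : c.idx Var.m1 = m := by simp [hm1]
  rw [Prog.exec, hidx]
  set μ := iterateM (fun k c' => fourierAttempt.exec f ((c'.set .ell k).tick 1)) m
    (c.tick (1 + CExpr.cost Var.m1)) with hμ
  have hI' : FourierInv M (c.tick (1 + CExpr.cost Var.m1)) := by simpa [FourierInv] using hI
  -- This t maximises the exponent |t| M e - M t² n²/8; the maximum is 2 M e²/n².
  set t := s * (4 * e / n ^ 2) with ht
  have h1 : wp μ (fun c' =>
      ENNReal.ofReal (weightPotential f t (c'.reg .found) (c'.reg .total))) ≤
      1 ^ m * ENNReal.ofReal (weightPotential f t (c.reg .found) (c.reg .total)) :=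
    wp_iterateM_le (I := FourierInv M) (fun k c hc c' hc' => (hc.set_ell k).attempt hc')
      (fun k c hc => by
        simpa using wp_attempt_weightPotential (f := f) t (hc.set_ell k).1) m hI'
  rw [hF, hT] at h1
  have h0 : weightPotential f t 0 0 = 1 := by simp [weightPotential]
  rw [h0, one_pow, ENNReal.ofReal_one, one_mul] at h1
  refine (wp_ite_le (2 * M * e ^ 2 / n ^ 2) (Φ := fun c' : Config n =>
    ENNReal.ofReal (weightPotential f t (c'.reg .found) (c'.reg .total))) ?_).trans ?_
  · rintro c' - ⟨hF', hT'⟩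
    apply ENNReal.ofReal_le_ofReal
    rw [weightPotential, Real.exp_le_exp, hF']
    have e1 : t ^ 2 * n ^ 2 / 8 = 2 * e ^ 2 / n ^ 2 := by
      rw [ht, mul_pow, hs]; field_simp; norm_num
    have e2 : 4 * e / n ^ 2 * (M * e) ≤
        4 * e / n ^ 2 * (s * (c'.reg .total - M * totalInfluence (signFn f))) := by gcongr
    have e3 : t * (c'.reg .total - M * totalInfluence (signFn f)) =
        4 * e / n ^ 2 * (s * (c'.reg .total - M * totalInfluence (signFn f))) := by
      rw [ht]; ring
    rw [e1, e3]
    have e4 : 4 * e / n ^ 2 * (M * e) - M * (2 * e ^ 2 / n ^ 2) = 2 * M * e ^ 2 / n ^ 2 := by ring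
    linarith
  · exact (mul_le_mul_right h1 _).trans (by rw [mul_one])

-- A bad estimate means that too few sets were found or that the sum over exactly M sets deviates to
-- one side, hence three terms.
open Classical in
theorem wp_fourierLoop (hn : 1 ≤ n) {M m : ℕ} (hM : 0 < M) (hm : 3 * M ≤ m) {c : Config n}
    (hI : FourierInv M c) (hm1 : c.reg .m1 = m) (hF : c.reg .found = 0) (hT : c.reg .total = 0)
    {e : ℝ} (he : 0 < e) :
    wp ((Prog.loop .ell Var.m1 fourierAttempt).exec f c)
        (fun c' => if |c'.reg .total / M - totalInfluence (signFn f)| ≤ e then 0 else 1) ≤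
      ENNReal.ofReal (Real.exp (-(m / 18))) +
        (ENNReal.ofReal (Real.exp (-(2 * M * e ^ 2 / n ^ 2))) +
          ENNReal.ofReal (Real.exp (-(2 * M * e ^ 2 / n ^ 2)))) := by
  have hM' : (0 : ℝ) < M := by exact_mod_cast hM
  refine le_trans ?_ (add_le_add (wp_fourierLoop_found (f := f) hm hI hm1 hF)
    (add_le_add (wp_fourierLoop_weight (f := f) hn hI hm1 hF hT (s := 1) (by norm_num) he)
      (wp_fourierLoop_weight (f := f) hn hI hm1 hF hT (s := -1) (by norm_num) he)))
  rw [← wp_add, ← wp_add]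
  refine wp_mono fun c' _ => ?_
  by_cases h1 : |c'.reg .total / M - totalInfluence (signFn f)| ≤ e
  · simp [h1]
  · rw [if_neg h1]
    by_cases h2 : c'.reg .found = M
    · rw [not_le, lt_abs] at h1
      have e1 : c'.reg .total - M * totalInfluence (signFn f) =
          M * (c'.reg .total / M - totalInfluence (signFn f)) := by field_simp
      rcases h1 with h1 | h1
      · rw [if_pos (c := c'.reg .found = M ∧ M * e ≤ 1 * _)]
        · exact le_add_left le_self_add
        · refine ⟨h2, ?_⟩
          rw [e1, one_mul]
          gcongr
      · rw [if_pos (c := c'.reg .found = M ∧ M * e ≤ -1 * _)]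
        · exact le_add_left (le_add_left le_rfl)
        · refine ⟨h2, ?_⟩
          rw [e1, neg_one_mul, ← mul_neg]
          gcongr
    · rw [if_pos h2]
      exact le_self_add

/-! ### Classical samples -/

theorem cubeFourier_singleton (f : (Fin n → Bool) → Bool) (i : Fin n) :
    cubeFourier (signFn f) {i} = ∑ x : Fin n → Bool, 1 / 2 ^ n * (bsign (x i) * bsign (f x)) := by
  rw [cubeFourier_eq, Finset.sum_div]
  refine Finset.sum_congr rfl fun x _ => ?_
  rw [Finset.prod_singleton, signFn_eq]
  ring

/-- Hoeffding's lemma on [-1, 1], where t² · 2²/8 = t²/2. -/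
theorem wp_sample_exp (t : ℝ) {c : Config n} (hn : c.reg .n = n) (i : Fin n) :
    wp (classicalSample.exec f c) (fun c' => ENNReal.ofReal (Real.exp (t * c'.mem i))) ≤
      ENNReal.ofReal (Real.exp (t * cubeFourier (signFn f) {i} + t ^ 2 / 2)) *
        ENNReal.ofReal (Real.exp (t * c.mem i)) := by
  rw [wp_classicalSample hn i fun x => ENNReal.ofReal (Real.exp (t * x)),
    ← ENNReal.ofReal_mul (Real.exp_pos _).le]
  have hoeff := sum_mul_exp_le (w := fun _ : Fin n → Bool => (1 : ℝ) / 2 ^ n)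
    (X := fun x => bsign (x i) * bsign (f x)) (a := -1) (b := 1) (fun x => by positivity)
    (by simp) (fun x => by cases x i <;> cases f x <;> simp) t
  rw [← cubeFourier_singleton] at hoeff
  have e : ∀ x : Fin n → Bool, ENNReal.ofReal (1 / 2 ^ n) *
      ENNReal.ofReal (Real.exp (t * (c.mem i + bsign (x i) * bsign (f x)))) =
      ENNReal.ofReal (Real.exp (t * cubeFourier (signFn f) {i}) * Real.exp (t * c.mem i) *
        (1 / 2 ^ n * Real.exp (t * (bsign (x i) * bsign (f x) -
          cubeFourier (signFn f) {i})))) := by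
    intro x
    rw [← ENNReal.ofReal_mul (by positivity)]
    congr 1
    rw [mul_left_comm, ← Real.exp_add, ← Real.exp_add]
    congr 2
    ring
  simp_rw [e]
  rw [← ENNReal.ofReal_sum_of_nonneg fun x _ => by positivity, ← Finset.mul_sum]
  apply ENNReal.ofReal_le_ofReal
  calc _ ≤ Real.exp (t * cubeFourier (signFn f) {i}) * Real.exp (t * c.mem i) *
        Real.exp (t ^ 2 * (1 - (-1)) ^ 2 / 8) := by gcongr
    _ = _ := by
        rw [← Real.exp_add, ← Real.exp_add, ← Real.exp_add]
        congr 1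
        ring

open Classical in
theorem wp_sampleLoop_side {m : ℕ} {c : Config n} (hn : c.reg .n = n) (hm5 : c.reg .m5 = m)
    {i : Fin n} (hi : c.mem i = 0) {s e : ℝ} (hs : s ^ 2 = 1) (he : 0 < e) :
    wp ((Prog.loop .ell Var.m5 classicalSample).exec f c)
        (fun c' => if m * e ≤ s * (c'.mem i - m * cubeFourier (signFn f) {i}) then 1 else 0) ≤
      ENNReal.ofReal (Real.exp (-(m * e ^ 2 / 2))) := by
  have hidx : c.idx Var.m5 = m := by simp [hm5]
  rw [Prog.exec, hidx]
  set μ := iterateM (fun k c' => classicalSample.exec f ((c'.set .ell k).tick 1)) m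
    (c.tick (1 + CExpr.cost Var.m5)) with hμ
  -- The optimal parameter: |t| m e - m t²/2 = m e²/2.
  set t := s * e with ht
  have h1 : wp μ (fun c' => ENNReal.ofReal (Real.exp (t * c'.mem i))) ≤
      ENNReal.ofReal (Real.exp (t * cubeFourier (signFn f) {i} + t ^ 2 / 2)) ^ m *
        ENNReal.ofReal (Real.exp (t * c.mem i)) :=
    wp_iterateM_le (I := fun c : Config n => c.reg .n = n)
      (fun k c hc c' hc' => (Prog.reg_eq_of_keeps f (by decide) hc').trans (by simpa using hc))
      (fun k c hc => by
        simpa using wp_sample_exp (f := f) t (c := (c.set .ell k).tick 1) (by simpa using hc) i)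
      m (by simpa using hn)
  rw [hi, mul_zero, Real.exp_zero, ENNReal.ofReal_one, mul_one,
    ← ENNReal.ofReal_pow (Real.exp_pos _).le, ← Real.exp_nat_mul] at h1
  refine (wp_ite_le (e * (m * e) + t * (m * cubeFourier (signFn f) {i})) (Φ := fun c' : Config n =>
    ENNReal.ofReal (Real.exp (t * c'.mem i))) ?_).trans ?_
  · intro c' _ hc'
    apply ENNReal.ofReal_le_ofReal
    rw [Real.exp_le_exp]
    have e2 : e * (m * e) ≤ e * (s * (c'.mem i - m * cubeFourier (signFn f) {i})) := by gcongr
    have e3 : e * (s * (c'.mem i - m * cubeFourier (signFn f) {i})) =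
        t * c'.mem i - t * (m * cubeFourier (signFn f) {i}) := by rw [ht]; ring
    linarith
  · refine (mul_le_mul_right h1 _).trans ?_
    rw [← ENNReal.ofReal_mul (Real.exp_pos _).le, ← Real.exp_add]
    apply ENNReal.ofReal_le_ofReal
    rw [Real.exp_le_exp, ht, mul_pow, hs]
    apply le_of_eq
    ring

open Classical in
theorem wp_sampleLoop {m : ℕ} (hm : 0 < m) {c : Config n} (hn : c.reg .n = n)
    (hm5 : c.reg .m5 = m) {i : Fin n} (hi : c.mem i = 0) {e : ℝ} (he : 0 < e) :
    wp ((Prog.loop .ell Var.m5 classicalSample).exec f c)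
        (fun c' => if |c'.mem i / m - cubeFourier (signFn f) {i}| ≤ e then 0 else 1) ≤
      ENNReal.ofReal (Real.exp (-(m * e ^ 2 / 2))) +
        ENNReal.ofReal (Real.exp (-(m * e ^ 2 / 2))) := by
  have hm' : (0 : ℝ) < m := by exact_mod_cast hm
  refine le_trans ?_ (add_le_add
    (wp_sampleLoop_side (f := f) hn hm5 hi (s := 1) (by norm_num) he)
    (wp_sampleLoop_side (f := f) hn hm5 hi (s := -1) (by norm_num) he))
  rw [← wp_add]
  refine wp_mono fun c' _ => ?_
  by_cases h1 : |c'.mem i / m - cubeFourier (signFn f) {i}| ≤ e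
  · simp [h1]
  · rw [if_neg h1]
    rw [not_le, lt_abs] at h1
    have e1 : c'.mem i - m * cubeFourier (signFn f) {i} =
        m * (c'.mem i / m - cubeFourier (signFn f) {i}) := by field_simp
    rcases h1 with h1 | h1
    · rw [if_pos (c := m * e ≤ 1 * _)]
      · exact le_self_add
      · rw [e1, one_mul]
        gcongr
    · rw [if_pos (c := m * e ≤ -1 * _)]
      · exact le_add_left le_rfl
      · rw [e1, neg_one_mul, ← mul_neg]
        gcongr

end tails

/-! ## Initialization -/

section init

variable {n : ℕ} {f : (Fin n → Bool) → Bool}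

/-- The program rounds up to an integer and the sample sizes are natural-number ceilings; they agree
because the logarithms are positive. The conditional assignment computes the maximum. -/
theorem initialization_spec (hn : 1 ≤ n) {ε δ : ℝ} (hε : 0 < ε) (hδ : 0 < δ)
    (hδ1 : δ < 1) {c : Config n}
    (h : c ∈ (initialization.exec f (initConfig n ε δ)).support) :
    c.reg .n = n ∧ c.reg .eps = ε ∧ c.reg .m2 = setCount n ε δ ∧
      c.reg .m1 = fourierCount n ε δ ∧ c.reg .m5 = sampleCount n ε δ := by
  have hn' : (1 : ℝ) ≤ n := by exact_mod_cast hn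
  have hp2 := log_two_div_pos hδ hδ1
  have hp5 := log_two_div_mul_pos hn hδ hδ1
  have hk : ∀ v, initialization.keeps v = true → c.reg v = (initConfig n ε δ).reg v :=
    fun v hv => Prog.reg_eq_of_keeps f hv h
  have e2 : ((⌈(n : ℝ) * n * Real.log (2 / (δ / 3)) / (2 * (ε / 3 * (ε / 3)))⌉ : ℤ) : ℝ) =
      (setCount n ε δ : ℝ) := by
    rw [setCount, ← sq, ← sq]
    exact (natCast_ceil_eq_intCast_ceil (by positivity)).symm
  have e1 : ((⌈18 * Real.log (2 / (δ / 3))⌉ : ℤ) : ℝ) =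
      (⌈18 * Real.log (2 / (δ / 3))⌉₊ : ℝ) :=
    (natCast_ceil_eq_intCast_ceil (by positivity)).symm
  have e5 : ((⌈4 * Real.log (2 / (δ / (3 * n))) / (ε / (3 * n) * (ε / (3 * n)))⌉ : ℤ) : ℝ) =
      (sampleCount n ε δ : ℝ) := by
    rw [sampleCount, ← sq]
    exact (natCast_ceil_eq_intCast_ceil (by positivity)).symm
  refine ⟨hk .n (by decide), hk .eps (by decide), ?_⟩
  have hf : (fourierCount n ε δ : ℝ) =
      max (3 * (setCount n ε δ : ℝ)) (⌈18 * Real.log (2 / (δ / 3))⌉₊ : ℝ) := by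
    rw [fourierCount]; push_cast; rfl
  simp only [initialization, Prog.exec, PMF.pure_bind] at h
  split_ifs at h with hle
  · simp only [PMF.pure_bind, PMF.mem_support_pure_iff] at h
    subst h
    simp [initConfig, e2, e1] at hle
    refine ⟨?_, ?_, ?_⟩
    · simp [initConfig, e2]
    · simp [initConfig, e2, hf, hle]
    · simp [initConfig, e5]
  · simp only [PMF.pure_bind, PMF.mem_support_pure_iff] at h
    subst h
    simp [initConfig, e2, e1] at hle
    refine ⟨?_, ?_, ?_⟩
    · simp [initConfig, e2]
    · simp [initConfig, e1, hf, hle.le]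
    · simp [initConfig, e5]

end init

/-! ## Running time -/

section cost

@[simp] theorem cost_var (v : Var) : (CExpr.var v).cost = 1 := rfl
@[simp] theorem cost_zero : (0 : CExpr).cost = 1 := rfl
@[simp] theorem cost_one : (1 : CExpr).cost = 1 := rfl
@[simp] theorem cost_two : (2 : CExpr).cost = 1 := rfl
@[simp] theorem cost_three : (3 : CExpr).cost = 1 := rfl
@[simp] theorem cost_four : (4 : CExpr).cost = 1 := rfl
@[simp] theorem cost_eighteen : (18 : CExpr).cost = 1 := rfl
@[simp] theorem cost_add (a b : CExpr) : (a + b).cost = a.cost + b.cost + 1 := rfl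
@[simp] theorem cost_sub (a b : CExpr) : (a - b).cost = a.cost + b.cost + 1 := rfl
@[simp] theorem cost_mul (a b : CExpr) : (a * b).cost = a.cost + b.cost + 1 := rfl
@[simp] theorem cost_div (a b : CExpr) : (a / b).cost = a.cost + b.cost + 1 := rfl
@[simp] theorem cost_arr (a : CExpr) : (CExpr.arr a).cost = a.cost + 1 := rfl
@[simp] theorem cost_log (a : CExpr) : (CExpr.log a).cost = a.cost + 1 := rfl
@[simp] theorem cost_ceil (a : CExpr) : (CExpr.ceil a).cost = a.cost + 1 := rfl

variable {n : ℕ} {f : (Fin n → Bool) → Bool}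

theorem Prog.Costs.weaken {I : (Var → ℝ) → Prop} {p : Prog} {T T' K K' : ℕ}
    (h : p.Costs f I T K) (hT : T ≤ T') (hK : K = K') : p.Costs f I T' K' := by
  intro c hc c' hc'
  obtain ⟨h1, h2, h3⟩ := h c hc c' hc'
  exact ⟨h1, by omega, by omega⟩

theorem initialization_costs : initialization.Costs f (fun _ => True) 100 0 := by
  have ha : ∀ v, Ignores (fun _ => True) v := fun _ _ _ _ => trivial
  have h := ((Prog.Costs.assign (f := f) (ha .eps2) (Var.eps / 3)).seq <|
    (Prog.Costs.assign (ha .eps5) (Var.eps / (3 * Var.n))).seq <|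
    (Prog.Costs.assign (ha .delta1) (Var.delta / 3)).seq <|
    (Prog.Costs.assign (ha .delta2) (Var.delta / 3)).seq <|
    (Prog.Costs.assign (ha .delta5) (Var.delta / (3 * Var.n))).seq <|
    (Prog.Costs.assign (ha .m2) (.ceil (Var.n * Var.n * .log (2 / Var.delta2) /
      (2 * (Var.eps2 * Var.eps2))))).seq <|
    (Prog.Costs.assign (ha .m1) (.ceil (18 * .log (2 / Var.delta1)))).seq <|
    (Prog.Costs.ifLE Var.m1 (3 * Var.m2) (Prog.Costs.assign (ha .m1) (3 * Var.m2)) .skip).seq <|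
    Prog.Costs.assign (ha .m5) (.ceil (4 * .log (2 / Var.delta5) / (Var.eps5 * Var.eps5))))
  exact h.weaken (by simp) rfl

/-- The values of the loop bounds. -/
def BoundsInv (n m₁ m₅ : ℕ) (r : Var → ℝ) : Prop := r .n = n ∧ r .m1 = m₁ ∧ r .m5 = m₅

variable {m₁ m₅ : ℕ}

theorem BoundsInv.ignores {v : Var} (h1 : v ≠ .n) (h2 : v ≠ .m1) (h3 : v ≠ .m5) :
    Ignores (BoundsInv n m₁ m₅) v := by
  intro r x h
  simpa [BoundsInv, h1.symm, h2.symm, h3.symm] using h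

theorem BoundsInv.eval_n (r : Var → ℝ) (mem : ℕ → ℝ) (h : BoundsInv n m₁ m₅ r) :
    CExpr.eval r mem Var.n = n := h.1

theorem fourierAttempt_costs :
    fourierAttempt.Costs f (BoundsInv n m₁ m₅) (15 * n + 50) 1 := by
  have ig : ∀ v, v ≠ .n → v ≠ .m1 → v ≠ .m5 → Ignores (BoundsInv n m₁ m₅) v :=
    fun _ => BoundsInv.ignores
  have h := (Prog.Costs.fresh (f := f)).seq <|
    (Prog.Costs.loop (ig .i (by decide) (by decide) (by decide)) (e := Var.n + 1) (m := n + 1)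
      (fun r mem h => by simp [h.1]) (Prog.Costs.had Var.i)).seq <|
    (Prog.Costs.meas (ig .label (by decide) (by decide) (by decide)) Var.n).seq <|
    Prog.Costs.ifLE 1 Var.label
      ((Prog.Costs.assign (ig .weight (by decide) (by decide) (by decide)) 0).seq <|
        (Prog.Costs.loop (ig .i (by decide) (by decide) (by decide)) BoundsInv.eval_n
          ((Prog.Costs.meas (ig .bit (by decide) (by decide) (by decide)) Var.i).seq
            (Prog.Costs.assign (ig .weight (by decide) (by decide) (by decide))
              (Var.weight + Var.bit)))).seq <|
        Prog.Costs.ifLE (Var.found + 1) Var.m2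
          ((Prog.Costs.assign (ig .total (by decide) (by decide) (by decide))
            (Var.total + Var.weight)).seq
            (Prog.Costs.assign (ig .found (by decide) (by decide) (by decide)) (Var.found + 1)))
          .skip)
      .skip
  exact h.weaken (by simp; omega) (by simp)

theorem classicalSample_costs :
    classicalSample.Costs f (BoundsInv n m₁ m₅) (25 * n + 50) 1 := by
  have ig : ∀ v, v ≠ .n → v ≠ .m1 → v ≠ .m5 → Ignores (BoundsInv n m₁ m₅) v :=
    fun _ => BoundsInv.ignores
  have h := (Prog.Costs.fresh (f := f)).seq <|
    (Prog.Costs.meas (ig .label (by decide) (by decide) (by decide)) Var.n).seq <|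
    Prog.Costs.loop (ig .i (by decide) (by decide) (by decide)) BoundsInv.eval_n
      ((Prog.Costs.meas (ig .bit (by decide) (by decide) (by decide)) Var.i).seq
        (Prog.Costs.store Var.i (.arr Var.i + (1 - 2 * Var.bit) * (1 - 2 * Var.label))))
  exact h.weaken (by simp; omega) (by simp)

/-- The part of the tester that follows the classical samples. -/
def evaluation : Prog :=
  .loop .i Var.n (.store Var.i (.arr Var.i / Var.m5));;
  .assign .gsum 0;;
  .loop .i Var.n (.assign .gsum (Var.gsum + .arr Var.i));;
  .assign .phat (Var.Ihat / (2 * Var.n) - Var.gsum / (2 * Var.n));;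
  .ifLE Var.phat (Var.eps / (3 * Var.n))
    (.answer true)
    (.ifLE (2 * Var.eps / (3 * Var.n)) Var.phat (.answer false) .skip)

/-- The part of the tester that follows the initialization. -/
def testerBody : Prog :=
  .assign .found 0;;
  .assign .total 0;;
  .loop .ell Var.m1 fourierAttempt;;
  .assign .Ihat (Var.total / Var.m2);;
  .loop .i Var.n (.store Var.i 0);;
  .loop .ell Var.m5 classicalSample;;
  evaluation

theorem tester_eq : tester = (initialization;; testerBody) := rfl

theorem evaluation_costs : evaluation.Costs f (BoundsInv n m₁ m₅) (20 * n + 100) 0 := by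
  have ig : ∀ v, v ≠ .n → v ≠ .m1 → v ≠ .m5 → Ignores (BoundsInv n m₁ m₅) v :=
    fun _ => BoundsInv.ignores
  have h := (Prog.Costs.loop (f := f) (ig .i (by decide) (by decide) (by decide))
      BoundsInv.eval_n (Prog.Costs.store Var.i (.arr Var.i / Var.m5))).seq <|
    (Prog.Costs.assign (ig .gsum (by decide) (by decide) (by decide)) 0).seq <|
    (Prog.Costs.loop (ig .i (by decide) (by decide) (by decide)) BoundsInv.eval_n
      (Prog.Costs.assign (ig .gsum (by decide) (by decide) (by decide))
        (Var.gsum + .arr Var.i))).seq <|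
    (Prog.Costs.assign (ig .phat (by decide) (by decide) (by decide))
      (Var.Ihat / (2 * Var.n) - Var.gsum / (2 * Var.n))).seq <|
    Prog.Costs.ifLE Var.phat (Var.eps / (3 * Var.n)) (.answer true)
      (Prog.Costs.ifLE (2 * Var.eps / (3 * Var.n)) Var.phat (.answer false) .skip)
  exact h.weaken (by simp; omega) (by simp)

theorem testerBody_costs : testerBody.Costs f (BoundsInv n m₁ m₅)
    ((m₁ + m₅) * (25 * n + 51) + 30 * n + 150) (m₁ + m₅) := by
  have ig : ∀ v, v ≠ .n → v ≠ .m1 → v ≠ .m5 → Ignores (BoundsInv n m₁ m₅) v :=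
    fun _ => BoundsInv.ignores
  have h := (Prog.Costs.assign (f := f) (ig .found (by decide) (by decide) (by decide)) 0).seq <|
    (Prog.Costs.assign (ig .total (by decide) (by decide) (by decide)) 0).seq <|
    (Prog.Costs.loop (ig .ell (by decide) (by decide) (by decide)) (e := Var.m1)
      (fun r mem h => h.2.1) fourierAttempt_costs).seq <|
    (Prog.Costs.assign (ig .Ihat (by decide) (by decide) (by decide)) (Var.total / Var.m2)).seq <|
    (Prog.Costs.loop (ig .i (by decide) (by decide) (by decide)) BoundsInv.eval_n
      (Prog.Costs.store Var.i 0)).seq <|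
    (Prog.Costs.loop (ig .ell (by decide) (by decide) (by decide)) (e := Var.m5)
      (fun r mem h => h.2.2) classicalSample_costs).seq <|
    evaluation_costs
  refine h.weaken ?_ (by simp)
  simp
  nlinarith [Nat.zero_le (m₁ * n)]

theorem runTester_cost (hn : 1 ≤ n) {ε δ : ℝ} (hε : 0 < ε) (hε1 : ε < 1) (hδ : 0 < δ)
    (hδ1 : δ < 1) {c : Config n} (hc : c ∈ (runTester f ε δ).support) :
    c.copies = copyCount n ε δ ∧
      (c.steps : ℝ) ≤ 10000 * (n ^ 3 * (1 + Real.log n + Real.log (1 / δ)) / ε ^ 2) := by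
  rw [runTester, tester_eq, Prog.exec, PMF.mem_support_bind_iff] at hc
  obtain ⟨c1, h1, h2⟩ := hc
  obtain ⟨s1, -, -, s2, s3⟩ := initialization_spec hn hε hδ hδ1 h1
  obtain ⟨-, a2, a3⟩ := initialization_costs _ trivial c1 h1
  obtain ⟨-, b2, b3⟩ := testerBody_costs c1 ⟨s1, s2, s3⟩ c h2
  have i1 : (initConfig n ε δ).steps = 0 := rfl
  have i2 : (initConfig n ε δ).copies = 0 := rfl
  rw [copyCount_eq]
  refine ⟨by omega, ?_⟩
  have hn' : (1 : ℝ) ≤ n := by exact_mod_cast hn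
  have hcopy := copyCount_le hn hε hε1 hδ hδ1
  rw [copyCount_eq] at hcopy
  have hL := one_le_log_factor (n := n) hδ hδ1
  set L := 1 + Real.log n + Real.log (1 / δ)
  have ha : 1 ≤ n ^ 2 * L / ε ^ 2 := by
    rw [le_div_iff₀ (by positivity)]
    have e1 : ε ^ 2 ≤ 1 := pow_le_one₀ hε.le hε1.le
    have e2 : (1 : ℝ) ≤ n ^ 2 := one_le_pow₀ hn'
    nlinarith
  have e3 : n ^ 3 * L / ε ^ 2 = n * (n ^ 2 * L / ε ^ 2) := by ring
  rw [e3]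
  set a := n ^ 2 * L / ε ^ 2
  set m := fourierCount n ε δ + sampleCount n ε δ with hm
  -- For n ≥ 1 one has 25n + 51 ≤ 76n and 30n + 150 + 100 ≤ 280n, the last 100 coming from the
  -- initialization.
  have hsteps : c.steps ≤ m * (76 * n) + 280 * n := by nlinarith
  have hsteps' : (c.steps : ℝ) ≤ m * (76 * n) + 280 * n := by exact_mod_cast hsteps
  have h5 : (m : ℝ) * (76 * n) ≤ 110 * a * (76 * n) := by gcongr
  nlinarith

end cost

/-! ## Evaluation of the estimates -/

section evaluation

variable {n : ℕ} {f : (Fin n → Bool) → Bool}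

/-- Pass k overwrites cell k only, so the value of e is needed just for memories in which cell k is
still the original one. -/
theorem storeLoop_spec {e : CExpr} {g : ℕ → ℝ} {c c' : Config n} (hn : c.reg .n = n)
    (he : ∀ (r : Var → ℝ) (mem : ℕ → ℝ) (k : ℕ), (∀ v, v ≠ .i → r v = c.reg v) → r .i = k →
      mem k = c.mem k → e.eval r mem = g k)
    (h : c' ∈ ((Prog.loop .i Var.n (.store Var.i e)).exec f c).support) :
    (∀ v, v ≠ .i → c'.reg v = c.reg v) ∧ ∀ i : Fin n, c'.mem i = g i := by
  have hidx : c.idx Var.n = n := by simp [hn]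
  simp only [Prog.exec, hidx] at h
  have key := iterateM_support (P := fun k c' => (∀ v, v ≠ .i → c'.reg v = c.reg v) ∧
    ∀ j : ℕ, c'.mem j = if j < k then g j else c.mem j) ?_ ?_ c' h
  · exact ⟨key.1, fun i => by rw [key.2, if_pos i.is_lt]⟩
  · rintro k - c1 ⟨h1, h2⟩ c2 hc2
    rw [PMF.mem_support_pure_iff] at hc2
    subst hc2
    refine ⟨fun v hv => by simp [hv, h1 v hv], fun j => ?_⟩
    have hv := he (Function.update c1.reg .i k) c1.mem k (fun v hv => by simp [hv, h1 v hv])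
      (by simp) (by rw [h2, if_neg (lt_irrefl k)])
    have hm : (((c1.set .i k).tick 1).idx Var.i) = k := by simp
    simp only [hm, Config.tick_mem, Config.set_mem]
    by_cases hj : j = k
    · subst hj
      simpa using hv
    · rw [Function.update_of_ne hj, h2]
      refine if_congr ?_ rfl rfl
      omega
  · exact ⟨fun _ _ => rfl, fun j => by simp⟩

theorem sumLoop_spec {c c' : Config n} (hn : c.reg .n = n) (hg : c.reg .gsum = 0)
    (h : c' ∈ ((Prog.loop .i Var.n (.assign .gsum (Var.gsum + .arr Var.i))).exec f c).support) :
    c'.mem = c.mem ∧ c'.reg .gsum = ∑ i : Fin n, c.mem i := by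
  have hidx : c.idx Var.n = n := by simp [hn]
  simp only [Prog.exec, hidx] at h
  have key := iterateM_support (P := fun k c' => c'.mem = c.mem ∧
    c'.reg .gsum = ∑ j ∈ Finset.range k, c.mem j) ?_ ?_ c' h
  · rw [← Finset.sum_range]; exact key
  · rintro k - c1 ⟨h1, h2⟩ c2 hc2
    rw [PMF.mem_support_pure_iff] at hc2
    subst hc2
    exact ⟨h1, by simp [Finset.sum_range_succ, h1, h2]⟩
  · exact ⟨rfl, by simp [hg]⟩

open Classical in
theorem decision_spec {c c' : Config n} (hn : c.reg .n = n)
    (h : c' ∈ ((Prog.ifLE Var.phat (Var.eps / (3 * Var.n)) (.answer true)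
      (.ifLE (2 * Var.eps / (3 * Var.n)) Var.phat (.answer false) .skip)).exec f c).support) :
    c'.reg = c.reg ∧ c'.mem = c.mem ∧
      c'.out = if c.reg .phat ≤ c.reg .eps / (3 * n) then some true
        else if 2 * c.reg .eps / (3 * n) ≤ c.reg .phat then some false else c'.out := by
  simp only [Prog.exec, Config.val_eq, eval_var, eval_div, eval_mul, eval_two, eval_three, hn,
    Config.tick_reg] at h
  split_ifs at h ⊢
  · rw [PMF.mem_support_pure_iff] at h; subst h; exact ⟨rfl, rfl, rfl⟩
  · rw [PMF.mem_support_pure_iff] at h; subst h; exact ⟨rfl, rfl, rfl⟩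
  · rw [PMF.mem_support_pure_iff] at h; subst h; exact ⟨rfl, rfl, rfl⟩

open Classical in
theorem evaluation_spec {c c' : Config n} (hn : c.reg .n = n)
    (h : c' ∈ (evaluation.exec f c).support) :
    c'.reg .Ihat = c.reg .Ihat ∧ (∀ i : Fin n, c'.mem i = c.mem i / c.reg .m5) ∧
      c'.reg .phat = c.reg .Ihat / (2 * n) - (∑ i : Fin n, c'.mem i) / (2 * n) ∧
      c'.out = if c'.reg .phat ≤ c.reg .eps / (3 * n) then some true
        else if 2 * c.reg .eps / (3 * n) ≤ c'.reg .phat then some false else c'.out := by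
  rw [evaluation, Prog.exec, PMF.mem_support_bind_iff] at h
  obtain ⟨c1, h1, h⟩ := h
  obtain ⟨r1, m1⟩ := storeLoop_spec (g := fun k => c.mem k / c.reg .m5) hn
    (fun r mem k hr hi hm => by simp [hi, hm, hr]) h1
  rw [Prog.exec, PMF.mem_support_bind_iff] at h
  obtain ⟨c1', h1', h⟩ := h
  rw [Prog.exec, PMF.mem_support_pure_iff] at h1'
  have r1' : ∀ v, v ≠ .gsum → c1'.reg v = c1.reg v := fun v hv => by simp [h1', hv]
  have g1' : c1'.reg .gsum = 0 := by simp [h1']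
  have m1' : c1'.mem = c1.mem := by rw [h1']; rfl
  clear h1'
  rw [Prog.exec, PMF.mem_support_bind_iff] at h
  obtain ⟨c2, h2, h⟩ := h
  obtain ⟨m2, g2⟩ := sumLoop_spec (by rw [r1' _ (by decide), r1 _ (by decide), hn]) g1' h2
  have r2 : ∀ v, v ≠ .i → v ≠ .gsum → c2.reg v = c.reg v := by
    intro v hi hg
    rw [Prog.reg_eq_of_keeps (v := v) f (by simp [Prog.keeps, hi.symm, hg.symm]) h2, r1' v hg,
      r1 v hi]
  rw [Prog.exec, PMF.mem_support_bind_iff] at h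
  obtain ⟨c3, h3, h⟩ := h
  rw [Prog.exec, PMF.mem_support_pure_iff] at h3
  have r3 : ∀ v, v ≠ .i → v ≠ .gsum → v ≠ .phat → c3.reg v = c.reg v := fun v k1 k2 k3 => by
    rw [← r2 v k1 k2]; simp [h3, k3]
  have p3 : c3.reg .phat = c.reg .Ihat / (2 * n) - (∑ i : Fin n, c1.mem i) / (2 * n) := by
    rw [← m1', ← g2]
    simp [h3, r2 .Ihat (by decide) (by decide), r2 .n (by decide) (by decide), hn]
  have m3 : c3.mem = c1.mem := by rw [← m1', ← m2, h3]; rfl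
  obtain ⟨d1, d2, d3⟩ := decision_spec (by rw [r3 _ (by decide) (by decide) (by decide), hn]) h
  rw [r3 .eps (by decide) (by decide) (by decide)] at d3
  refine ⟨?_, fun i => ?_, ?_, ?_⟩
  · rw [d1, r3 _ (by decide) (by decide) (by decide)]
  · rw [d2, m3, m1]
  · rw [d1, d2, m3, p3]
  · rwa [d1]

end evaluation

/-! ## Correctness -/

section correctness

variable {n : ℕ} {f : (Fin n → Bool) → Bool}

/-- All conclusions about the final configuration. -/
def Correct (f : (Fin n → Bool) → Bool) (ε : ℝ) (c : Config n) : Prop :=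
  (Monotone f → c.out = some true) ∧
    (FarFromMonotone ε f → c.out = some false) ∧
    |c.reg Var.Ihat - totalInfluence (signFn f)| ≤ ε / 3 ∧
    (∀ i : Fin n, |c.mem i - cubeFourier (signFn f) {i}| ≤ ε / (3 * n)) ∧
    |c.reg Var.phat - violationProb f| ≤ ε / (3 * n)

/-- By part (a) the error of the estimate of p(f) is at most (ε/3 + n · ε/3n)/2n = ε/3n. As p(f) is
0 or at least ε/n in the two cases, the thresholds ε/3n and 2ε/3n decide correctly. -/
theorem correct_of_estimates (hn : 1 ≤ n) {ε : ℝ} (hε : 0 < ε) {c c' : Config n}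
    (hcn : c.reg .n = n) (hce : c.reg .eps = ε)
    (hI : |c.reg .Ihat - totalInfluence (signFn f)| ≤ ε / 3)
    (hg : ∀ i : Fin n, |c.mem i / c.reg .m5 - cubeFourier (signFn f) {i}| ≤ ε / (3 * n))
    (h : c' ∈ (evaluation.exec f c).support) : Correct f ε c' := by
  have hn' : (0 : ℝ) < n := by exact_mod_cast hn
  obtain ⟨e1, e2, e3, e4⟩ := evaluation_spec hcn h
  rw [hce] at e4
  have hg' : ∀ i : Fin n, |c'.mem i - cubeFourier (signFn f) {i}| ≤ ε / (3 * n) := fun i => by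
    rw [e2]; exact hg i
  have hsum : |∑ i : Fin n, c'.mem i - ∑ i, cubeFourier (signFn f) {i}| ≤ ε / 3 := by
    rw [← Finset.sum_sub_distrib]
    refine (Finset.abs_sum_le_sum_abs _ _).trans ((Finset.sum_le_sum fun i _ => hg' i).trans ?_)
    rw [Finset.sum_const, Finset.card_univ, Fintype.card_fin, nsmul_eq_mul]
    apply le_of_eq
    field_simp
  have hp : |c'.reg .phat - violationProb f| ≤ ε / (3 * n) := by
    have : c'.reg .phat - violationProb f = ((c.reg .Ihat - totalInfluence (signFn f)) -
        (∑ i : Fin n, c'.mem i - ∑ i, cubeFourier (signFn f) {i})) / (2 * n) := by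
      rw [e3, violationProb_eq_fourier]
      ring
    rw [this, abs_div, abs_of_pos (show (0 : ℝ) < 2 * n by positivity),
      div_le_div_iff₀ (by positivity) (by positivity)]
    have := (abs_sub (c.reg .Ihat - totalInfluence (signFn f))
      (∑ i : Fin n, c'.mem i - ∑ i, cubeFourier (signFn f) {i}))
    nlinarith
  refine ⟨fun hm => ?_, fun hf => ?_, by rwa [e1], hg', hp⟩
  · rw [violationProb_of_monotone hm, sub_zero] at hp
    rw [e4, if_pos ((le_abs_self _).trans hp)]
  · have h1 := hf.le_violationProb hn
    have h2 := (abs_le.mp hp).1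
    have h3 : ε / n = 3 * (ε / (3 * n)) := by field_simp
    have h4 : 2 * ε / (3 * n) = 2 * (ε / (3 * n)) := by ring
    have h5 : 0 < ε / (3 * n) := by positivity
    rw [e4, if_neg (by linarith), if_pos (by linarith)]

open Classical in
/-- The failure probability in terms of the failure probabilities of the estimates. -/
theorem wp_evaluation_le (hn : 1 ≤ n) {ε : ℝ} (hε : 0 < ε) {c : Config n}
    (hcn : c.reg .n = n) (hce : c.reg .eps = ε) :
    wp (evaluation.exec f c) (fun c' => if Correct f ε c' then 0 else 1) ≤
      (if |c.reg .Ihat - totalInfluence (signFn f)| ≤ ε / 3 then 0 else 1) +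
        ∑ i : Fin n,
          if |c.mem i / c.reg .m5 - cubeFourier (signFn f) {i}| ≤ ε / (3 * n) then 0 else 1 := by
  refine wp_le_of_support fun c' hc' => ?_
  by_cases hI : |c.reg .Ihat - totalInfluence (signFn f)| ≤ ε / 3
  · by_cases hg : ∀ i : Fin n,
      |c.mem i / c.reg .m5 - cubeFourier (signFn f) {i}| ≤ ε / (3 * n)
    · simp [correct_of_estimates hn hε hcn hce hI hg hc']
    · push Not at hg
      obtain ⟨i, hi⟩ := hg
      refine le_add_left (le_trans ?_ (Finset.single_le_sum (fun _ _ => zero_le)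
        (Finset.mem_univ i)))
      rw [if_neg (not_le.mpr hi)]
      split_ifs <;> simp
  · rw [if_neg hI]
    refine le_add_right ?_
    split_ifs <;> simp

theorem exp_neg_le_of_log_le {x y : ℝ} (hy : 0 < y) (h : Real.log y ≤ x) :
    Real.exp (-x) ≤ 1 / y := by
  rw [one_div, ← Real.exp_log (inv_pos.mpr hy), Real.log_inv, Real.exp_le_exp]
  linarith

-- The failure bound for the classical samples holds from every configuration in which the Fourier
-- loop can end, so the failure probabilities simply add. The three Fourier terms are δ/6 each and
-- the 2n sampling terms δ/6n each, in total 5δ/6.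
open Classical in
theorem wp_testerBody_le (hn : 1 ≤ n) {ε δ : ℝ} (hε : 0 < ε) (hδ : 0 < δ)
    (hδ1 : δ < 1) {c : Config n} (hcn : c.reg .n = n) (hce : c.reg .eps = ε)
    (h2 : c.reg .m2 = setCount n ε δ) (h1 : c.reg .m1 = fourierCount n ε δ)
    (h5 : c.reg .m5 = sampleCount n ε δ) :
    wp (testerBody.exec f c) (fun c' => if Correct f ε c' then 0 else 1) ≤
      ENNReal.ofReal δ := by
  have hn' : (0 : ℝ) < n := by exact_mod_cast hn
  have hp2 := log_two_div_pos hδ hδ1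
  have hp5 := log_two_div_mul_pos hn hδ hδ1
  have c2pos : 0 < setCount n ε δ := Nat.ceil_pos.mpr (by positivity)
  have c5pos : 0 < sampleCount n ε δ := Nat.ceil_pos.mpr (by positivity)
  have c2le : Real.log (2 / (δ / 3)) ≤ 2 * setCount n ε δ * (ε / 3) ^ 2 / n ^ 2 := by
    have := Nat.le_ceil ((n : ℝ) ^ 2 * Real.log (2 / (δ / 3)) / (2 * (ε / 3) ^ 2))
    rw [div_le_iff₀ (by positivity)] at this
    rw [le_div_iff₀ (by positivity)]
    unfold setCount
    linarith
  have c1le : Real.log (2 / (δ / 3)) ≤ fourierCount n ε δ / 18 := by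
    have := Nat.le_ceil (18 * Real.log (2 / (δ / 3)))
    have h' : (⌈18 * Real.log (2 / (δ / 3))⌉₊ : ℝ) ≤ fourierCount n ε δ := by
      exact_mod_cast le_max_right _ _
    linarith
  have c5le : Real.log (2 / (δ / (3 * n))) ≤
      sampleCount n ε δ * (ε / (3 * n)) ^ 2 / 2 := by
    have := Nat.le_ceil (4 * Real.log (2 / (δ / (3 * n))) / (ε / (3 * n)) ^ 2)
    rw [div_le_iff₀ (by positivity)] at this
    unfold sampleCount
    linarith
  have b2 := exp_neg_le_of_log_le (by positivity) c2le
  have b1 := exp_neg_le_of_log_le (by positivity) c1le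
  have b5 := exp_neg_le_of_log_le (by positivity) c5le
  set B := ∑ _i : Fin n, (ENNReal.ofReal (1 / (2 / (δ / (3 * n)))) +
    ENNReal.ofReal (1 / (2 / (δ / (3 * n))))) with hB
  rw [testerBody, Prog.exec, Prog.exec, PMF.pure_bind, Prog.exec, Prog.exec, PMF.pure_bind,
    Prog.exec, wp_bind]
  set ca := (c.set .found (c.val 0)).tick (1 + CExpr.cost 0)
  set cb := (ca.set .total (ca.val 0)).tick (1 + CExpr.cost 0) with hcb
  have rb : ∀ v, v ≠ .found → v ≠ .total → cb.reg v = c.reg v := by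
    intro v hf ht
    simp [hcb, ca, hf, ht]
  have hI : FourierInv (setCount n ε δ) cb :=
    ⟨by rw [rb _ (by decide) (by decide), hcn], by rw [rb _ (by decide) (by decide), h2],
      0, Nat.zero_le _, by simp [hcb, ca]⟩
  have tail1 := wp_fourierLoop (f := f) hn c2pos (le_max_left _ _) hI
    (m := fourierCount n ε δ) (by rw [rb _ (by decide) (by decide), h1])
    (by simp [hcb, ca]) (by simp [hcb]) (e := ε / 3) (by positivity)
  calc _ ≤ wp ((Prog.loop .ell Var.m1 fourierAttempt).exec f cb) (fun c' =>
        (if |c'.reg .total / setCount n ε δ - totalInfluence (signFn f)| ≤ ε / 3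
          then 0 else 1) + B) := by
        refine wp_mono fun cc hcc => ?_
        have rc : ∀ v, v ≠ .ell → fourierAttempt.keeps v = true → cc.reg v = cb.reg v := by
          intro v hv hk
          exact Prog.reg_eq_of_keeps f (by simp [Prog.keeps, hv.symm, hk]) hcc
        rw [Prog.exec, Prog.exec, PMF.pure_bind, Prog.exec, wp_bind]
        set cd := (cc.set .Ihat (cc.val (Var.total / Var.m2))).tick
          (1 + (Var.total / Var.m2 : CExpr).cost) with hcd
        have rd : ∀ v, v ≠ .Ihat → cd.reg v = cc.reg v := fun v hv => by simp [hcd, hv]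
        have dI : cd.reg .Ihat = cc.reg .total / setCount n ε δ := by
          have : cc.reg .m2 = setCount n ε δ := by
            rw [rc _ (by decide) (by decide), rb _ (by decide) (by decide), h2]
          simp [hcd, this]
        have rcd : ∀ v, v ≠ .Ihat → v ≠ .ell → v ≠ .found → v ≠ .total →
            fourierAttempt.keeps v = true → cd.reg v = c.reg v := by
          intro v k1 k2 k3 k4 k5
          rw [rd v k1, rc v k2 k5, rb v k3 k4]
        refine wp_le_of_support fun ce hce' => ?_
        obtain ⟨re, me⟩ := storeLoop_spec (g := fun _ => 0)
          (by rw [rcd _ (by decide) (by decide) (by decide) (by decide) (by decide), hcn])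
          (fun r mem k _ _ _ => by simp) hce'
        have en : ce.reg .n = n := by
          rw [re _ (by decide),
            rcd _ (by decide) (by decide) (by decide) (by decide) (by decide), hcn]
        have ee : ce.reg .eps = ε := by
          rw [re _ (by decide),
            rcd _ (by decide) (by decide) (by decide) (by decide) (by decide), hce]
        have e5 : ce.reg .m5 = sampleCount n ε δ := by
          rw [re _ (by decide),
            rcd _ (by decide) (by decide) (by decide) (by decide) (by decide), h5]
        have eI : ce.reg .Ihat = cc.reg .total / setCount n ε δ := by
          rw [re _ (by decide), dI]
        rw [Prog.exec, wp_bind]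
        calc _ ≤ wp ((Prog.loop .ell Var.m5 classicalSample).exec f ce) (fun c' =>
              (if |cc.reg .total / setCount n ε δ - totalInfluence (signFn f)| ≤ ε / 3
                then 0 else 1) +
              ∑ i : Fin n, if |c'.mem i / sampleCount n ε δ - cubeFourier (signFn f) {i}| ≤
                ε / (3 * n) then 0 else 1) := by
              refine wp_mono fun cf hcf => ?_
              have rf : ∀ v, v ≠ .ell → classicalSample.keeps v = true →
                  cf.reg v = ce.reg v := fun v hv hk =>
                Prog.reg_eq_of_keeps f (by simp [Prog.keeps, hv.symm, hk]) hcf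
              have := wp_evaluation_le (f := f) hn hε (c := cf)
                (by rw [rf _ (by decide) (by decide), en])
                (by rw [rf _ (by decide) (by decide), ee])
              rwa [rf .Ihat (by decide) (by decide), rf .m5 (by decide) (by decide), e5, eI] at this
          _ ≤ _ := by
              -- The influence estimate is already fixed, so its failure indicator is a constant
              -- here.
              rw [wp_add, wp_const, wp_sum]
              refine add_le_add le_rfl (Finset.sum_le_sum fun i _ => ?_)
              refine (wp_sampleLoop (f := f) c5pos en e5 (me i) (e := ε / (3 * n))
                (by positivity)).trans ?_
              exact add_le_add (ENNReal.ofReal_le_ofReal b5) (ENNReal.ofReal_le_ofReal b5)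
    _ ≤ (ENNReal.ofReal (1 / (2 / (δ / 3))) + (ENNReal.ofReal (1 / (2 / (δ / 3))) +
          ENNReal.ofReal (1 / (2 / (δ / 3))))) + B := by
        rw [wp_add, wp_const]
        refine add_le_add (tail1.trans ?_) le_rfl
        exact add_le_add (ENNReal.ofReal_le_ofReal b1)
          (add_le_add (ENNReal.ofReal_le_ofReal b2) (ENNReal.ofReal_le_ofReal b2))
    _ ≤ ENNReal.ofReal δ := by
        have e2 : 1 / (2 / (δ / 3)) = δ / 6 := by field_simp; norm_num
        have e5 : 1 / (2 / (δ / (3 * n))) = δ / (6 * n) := by field_simp; norm_num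
        rw [hB, e2, e5, Finset.sum_const, Finset.card_univ, Fintype.card_fin, nsmul_eq_mul,
          ← ENNReal.ofReal_add (by positivity) (by positivity),
          ← ENNReal.ofReal_add (by positivity) (by positivity),
          ← ENNReal.ofReal_add (by positivity) (by positivity), ← ENNReal.ofReal_natCast,
          ← ENNReal.ofReal_mul (by positivity),
          ← ENNReal.ofReal_add (by positivity) (by positivity)]
        apply ENNReal.ofReal_le_ofReal
        have : (n : ℝ) * (δ / (6 * n) + δ / (6 * n)) = δ / 3 := by field_simp; norm_num
        rw [this]
        linarith

theorem le_toOuterMeasure_correct (hn : 1 ≤ n) {ε δ : ℝ} (hε : 0 < ε) (hδ : 0 < δ)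
    (hδ1 : δ < 1) :
    ENNReal.ofReal (1 - δ) ≤ (runTester f ε δ).toOuterMeasure {c | Correct f ε c} := by
  classical
  have hbad : wp (runTester f ε δ) (fun c => if Correct f ε c then 0 else 1) ≤
      ENNReal.ofReal δ := by
    rw [runTester, tester_eq, Prog.exec, wp_bind]
    refine wp_le_of_support fun c hc => ?_
    obtain ⟨s1, s2, s3, s4, s5⟩ := initialization_spec hn hε hδ hδ1 hc
    exact wp_testerBody_le hn hε hδ hδ1 s1 s2 s3 s4 s5
  have hsum : (runTester f ε δ).toOuterMeasure {c | Correct f ε c} +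
      wp (runTester f ε δ) (fun c => if Correct f ε c then 0 else 1) = 1 := by
    rw [← wp_indicator, ← wp_add]
    refine wp_eq_of_support fun c _ => ?_
    by_cases h : Correct f ε c <;> simp [h]
  rw [ENNReal.ofReal_sub _ hδ.le, ENNReal.ofReal_one, tsub_le_iff_right, ← hsum]
  gcongr

end correctness

end QTest

theorem mainTheorem1 :
    -- the violation probability in terms of Fourier-analytic quantities
    (∀ (n : ℕ), 1 ≤ n → ∀ f : (Fin n → Bool) → Bool,
      violationProb f =
        (totalInfluence (signFn f) - ∑ i, cubeFourier (signFn f) {i}) / (2 * n)) ∧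
    -- the tester: copies used, running time, and success probability
    ∃ C : ℝ, 0 < C ∧
      ∀ (n : ℕ), 1 ≤ n → ∀ (f : (Fin n → Bool) → Bool) (ε δ : ℝ),
        0 < ε → ε < 1 → 0 < δ → δ < 1 →
        (∀ c ∈ (runTester f ε δ).support,
          c.copies = copyCount n ε δ ∧
          (c.steps : ℝ) ≤ C * (n ^ 3 * (1 + Real.log n + Real.log (1 / δ)) / ε ^ 2)) ∧
        (copyCount n ε δ : ℝ) ≤ C * (n ^ 2 * (1 + Real.log n + Real.log (1 / δ)) / ε ^ 2) ∧
        (δ ≤ 1 / 2 →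
          (copyCount n ε δ : ℝ) ≤ C * (n ^ 2 * (1 + Real.log n) * Real.log (1 / δ) / ε ^ 2)) ∧
        ENNReal.ofReal (1 - δ) ≤
          (runTester f ε δ).toOuterMeasure
            {c | (Monotone f → c.out = some true) ∧
              (FarFromMonotone ε f → c.out = some false) ∧
              |c.reg Var.Ihat - totalInfluence (signFn f)| ≤ ε / 3 ∧
              (∀ i : Fin n, |c.mem i - cubeFourier (signFn f) {i}| ≤ ε / (3 * n)) ∧
              |c.reg Var.phat - violationProb f| ≤ ε / (3 * n)} := by
  -- The constant covers the running time, where 110 · 76 + 280 = 8640, and both copy bounds, with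
  -- 110 and 3 · 110.
  refine ⟨fun n _ f => violationProb_eq_fourier f, 10000, by norm_num, ?_⟩
  intro n hn f ε δ hε hε1 hδ hδ1
  have hn' : (1 : ℝ) ≤ n := by exact_mod_cast hn
  have hcopy := copyCount_le hn hε hε1 hδ hδ1
  have hL := one_le_log_factor (n := n) hδ hδ1
  refine ⟨fun c hc => runTester_cost hn hε hε1 hδ hδ1 hc, hcopy.trans ?_, fun hδ2 => ?_,
    le_toOuterMeasure_correct hn hε hδ hδ1⟩
  · gcongr
    norm_num
  · refine hcopy.trans ?_
    have h3 := log_factor_le (n := n) hδ hδ2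
    have hpos : 0 ≤ (1 + Real.log n) * Real.log (1 / δ) := by linarith
    calc _ ≤ 110 * (n ^ 2 * (3 * ((1 + Real.log n) * Real.log (1 / δ))) / ε ^ 2) := by gcongr
      _ = 330 * (n ^ 2 * ((1 + Real.log n) * Real.log (1 / δ)) / ε ^ 2) := by ring
      _ ≤ 10000 * (n ^ 2 * ((1 + Real.log n) * Real.log (1 / δ)) / ε ^ 2) := by
          gcongr
          norm_num
      _ = _ := by ring
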